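/- Let $G=\mathbb Z/r_1\mathbb Z\times\dots\times\mathbb Z/r_n\mathbb Z$ with $n\ge 1$, $r_j\ge 1$ and $r_j\mid r_{j+1}$, and let $\mathbb F_q$ be a finite field with $q\equiv 1\pmod{r_n}$. Let $\mathcal R$ be the set of non-zero integer vectors $\vec\alpha=(\alpha_1,\dots,\alpha_n)$ with $0\le\alpha_j\le r_j-1$, and let $\vec d=(d(\vec\alpha))_{\vec\alpha\in\mathcal R}$ be non-negative integers with $\sum_{\vec\alpha}\alpha_j d(\vec\alpha)\equiv 0\pmod{r_j}$ for all $j$. Let $\hat{\mathcal F}_{[\vec d]}$ be the set of pairs $(\vec c,(f_{\vec\alpha})_{\vec\alpha\in\mathcal R})$ where $\vec c\in(\mathbb F_q^*)^n$ and the $f_{\vec\alpha}\in\mathbb F_q[X]$ are monic, squarefree and pairwise coprime, such that either $\deg f_{\vec\alpha}=d(\vec\alpha)$ for all $\vec\alpha$, or, for one $\vec\beta\in\mathcal R$, $\deg f_{\vec\beta}=d(\vec\beta)-1$ and $\deg f_{\vec\alpha}=d(\vec\alpha)$ for all $\vec\alpha\ne\vec\beta$. For each $m\mid r_n$ let $\chi_m$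 be a complex multiplicative character of $\mathbb F_q^*$ of exact order $m$, with $\chi_m(0)=0$. For a vector $\vec s=(s_1,\dots,s_n)$ with $s_j\mid r_j$ put $\ell(\vec s)=\operatorname{lcm}(s_1,\dots,s_n)$ and $\Omega_{\vec s}=\{\vec\omega: 1\le\omega_j\le s_j,\ (\omega_j,s_j)=1\}$. For $(\vec c,(f_{\vec\alpha}))\in\hat{\mathcal F}_{[\vec d]}$ and $\vec\omega\in\Omega_{\vec s}$ put $$c_{(\vec s)}^{(\vec\omega)}=\prod_{j} c_j^{\,\frac{\ell(\vec s)}{s_j}\omega_j \bmod \ell(\vec s)},\qquad F_{(\vec s)}^{(\vec\omega)}(X)=c_{(\vec s)}^{(\vec\omega)}\prod_{\vec\alpha\in\mathcal R} f_{\vec\alpha}(X)^{\,\left(\sum_{j}\frac{\ell(\vec s)}{s_j}\omega_j\alpha_j\right) \bmod \ell(\vec s)},$$ where the exponents are the least non-negative residues. At the point at infinity, with $d_j=\sum_{\vec\alpha}\alpha_j\deg f_{\vec\alpha}$, put $F_{(\vec s)}^{(\vec\omega)}(\infty)=c_{(\vec s)}^{(\vec\omega)}$ if $\sum_j\frac{\ell(\vec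 s)}{s_j}\omega_jd_j\equiv0\pmod{\ell(\vec s)}$, and $F_{(\vec s)}^{(\vec\omega)}(\infty)=0$ otherwise. Let $x_1,\dots,x_{q+1}$ be the points of $\mathbb P^1(\mathbb F_q)$, and let each of $e_1,\dots,e_{q+1}$ be $0$ or of the form $|G|/s$ with $s\mid r_n$. Let $m_0=|\{i:e_i=0\}|$ and, for $s\mid r_n$, $m_s=|\{i:e_i=|G|/s\}|$. Then $$\frac{\left|\left\{(\vec c,(f_{\vec\alpha}))\in\hat{\mathcal F}_{[\vec d]}:\ \sum_{\vec s}\sum_{\vec\omega\in\Omega_{\vec s}}\chi_{\ell(\vec s)}\!\left(F_{(\vec s)}^{(\vec\omega)}(x_i)\right)=e_i,\ i=1,\dots,q+1\right\}\right|}{|\hat{\mathcal F}_{[\vec d]}|}$$ $$=\left(\frac{(|G|-1)(q+|G|)-\sum_{s\mid r_n}s\phi_G(s)+1}{|G|(q+|G|-1)}\right)^{m_0}\left(\frac{q}{|G|(q+|G|-1)}\right)^{m_1}\prod_{\substack{s\mid r_n\\ s\ne1}}\left(\frac{s\phi_G(s)}{|G|(q+|G|-1)}\right)^{m_s}\left(1+O\!\left(q^{-\frac12\min_{\vec\alpha}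 d(\vec\alpha)}\right)\right),$$ where $\phi_G(s)$ is the number of elements of order $s$ in $G$ and the implied constant depends only on $G$ (through $r_1,\dots,r_n$) and $q$. (If $\hat{\mathcal F}_{[\vec d]}$ is empty, the left side is read as $0$; for trivial $G$ the minimum over the empty set is read as $0$.) -/

import Mathlib

open Polynomial

noncomputable section

namespace AbelianCovers

variable {n : ℕ}

/-- The order `|G| = r₁ ⋯ rₙ` of `G = ℤ/r₁ × ⋯ × ℤ/rₙ`. The number of cyclic factors is written
`n + 1`, so that there is a last one. -/
def groupOrder (r : Fin (n + 1) → ℕ) : ℕ := ∏ j, r j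

/-- `φ_G(s)`: the number of elements of order `s` in `G = ∏ j, ℤ/r_j`. -/
def phiG (r : Fin (n + 1) → ℕ) (s : ℕ) : ℕ :=
  Nat.card {g : (j : Fin (n + 1)) → ZMod (r j) // addOrderOf g = s}

/-- The index set `R`: the non-zero integer vectors `α` with `0 ≤ α_j ≤ r_j - 1`. -/
abbrev Idx (r : Fin (n + 1) → ℕ) : Type :=
  {α : (j : Fin (n + 1)) → Fin (r j) // ∃ j, (α j : ℕ) ≠ 0}

/-- The vectors `s = (s_j)` with `s_j ∣ r_j` (for positive `r_j`). -/
def divVectors (r : Fin (n + 1) → ℕ) : Finset (Fin (n + 1) → ℕ) :=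
  Fintype.piFinset fun j => (r j).divisors

/-- `ℓ(s) = lcm(s_j)`. -/
def ell (s : Fin (n + 1) → ℕ) : ℕ := Finset.univ.lcm s

/-- `Ω_s`: the vectors `ω` with `1 ≤ ω_j ≤ s_j` and `gcd(ω_j, s_j) = 1`. -/
def Omega (s : Fin (n + 1) → ℕ) : Finset (Fin (n + 1) → ℕ) :=
  Fintype.piFinset fun j => (Finset.Icc 1 (s j)).filter fun w => Nat.Coprime w (s j)

variable {F : Type*} [Field F]

/-- Pairs `(c, (f_α))` of a vector of non-zero constants and a family of polynomials. -/
abbrev Datum (F : Type*) [Field F] (r : Fin (n + 1) → ℕ) : Type _ :=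
  (Fin (n + 1) → Fˣ) × (Idx r → F[X])

/-- `F̂_[d]`: the `f_α` are monic, squarefree and pairwise coprime, and either `deg f_α = d α` for
all `α`, or there is one index `β` with `deg f_β = d β - 1` (in the integers; so there is no such
family if `d β = 0`) and `deg f_α = d α` for `α ≠ β`. -/
def Fhat (F : Type*) [Field F] (r : Fin (n + 1) → ℕ) (d : Idx r → ℕ) : Set (Datum F r) :=
  {p | (∀ α, (p.2 α).Monic ∧ Squarefree (p.2 α)) ∧
    (∀ α β, α ≠ β → IsCoprime (p.2 α) (p.2 β)) ∧
    ((∀ α, (p.2 α).natDegree = d α) ∨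
      ∃ β, (p.2 β).natDegree + 1 = d β ∧ ∀ α, α ≠ β → (p.2 α).natDegree = d α)}

/-- `c_(s)^(ω) = ∏ j, c_j ^ ((ℓ(s)/s_j) ω_j mod ℓ(s))`. -/
def leadCoeff (s ω : Fin (n + 1) → ℕ) (c : Fin (n + 1) → Fˣ) : F :=
  ∏ j, (c j : F) ^ (ell s / s j * ω j % ell s)

/-- The polynomial
`F_(s)^(ω) = c_(s)^(ω) ∏ α, f_α ^ ((∑ j, (ℓ(s)/s_j) ω_j α_j) mod ℓ(s))`. -/
def Fpoly {r : Fin (n + 1) → ℕ} (s ω : Fin (n + 1) → ℕ) (p : Datum F r) : F[X] :=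
  C (leadCoeff s ω p.1) * ∏ α : Idx r, p.2 α ^ ((∑ j, ell s / s j * ω j * (α.1 j : ℕ)) % ell s)

/-- `d_j = ∑ α, α_j deg f_α`, the degree of `F_j = c_j ∏ α, f_α ^ α_j`. -/
def degF {r : Fin (n + 1) → ℕ} (p : Datum F r) (j : Fin (n + 1)) : ℕ :=
  ∑ α : Idx r, (α.1 j : ℕ) * (p.2 α).natDegree

/-- The value of `F_(s)^(ω)` at a point of `ℙ¹(F) = F ∪ {∞}`: the usual one at a finite point; at
`∞` it is `c_(s)^(ω)` if `∑ j, (ℓ(s)/s_j) ω_j d_j ≡ 0 mod ℓ(s)`, and `0` otherwise. -/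
def Fval {r : Fin (n + 1) → ℕ} (s ω : Fin (n + 1) → ℕ) (p : Datum F r) : OnePoint F → F
  | none => if ell s ∣ ∑ j, ell s / s j * ω j * degF p j then leadCoeff s ω p.1 else 0
  | some x => (Fpoly s ω p).eval x

/-- The character sum `∑ s, ∑ ω ∈ Ω_s, χ_{ℓ(s)}(F_(s)^(ω)(x))` at a point `x` of `ℙ¹(F)`. -/
def charSum {r : Fin (n + 1) → ℕ} (χ : ℕ → MulChar F ℂ) (p : Datum F r) (x : OnePoint F) : ℂ :=
  ∑ s ∈ divVectors r, ∑ ω ∈ Omega s, χ (ell s) (Fval s ω p x)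

/-- The number of points `x` of `ℙ¹(F)` with `e x = k`. -/
def mult (e : OnePoint F → ℕ) (k : ℕ) : ℕ := Nat.card {x : OnePoint F // e x = k}

/-- The main term `P₀^{m₀} P₁^{m₁} ∏_{s ∣ rₙ, s ≠ 1} P_s^{m_s}`, where `m₀` is the number of points
with `e x = 0`, `m_s` is the number of points with `e x = |G|/s`, and
`P₀ = ((|G|-1)(q+|G|) - ∑_{s ∣ rₙ} s φ_G(s) + 1) / (|G|(q+|G|-1))`, `P₁ = q / (|G|(q+|G|-1))`,
`P_s = s φ_G(s) / (|G|(q+|G|-1))` for `s ≠ 1`. -/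
def mainTerm [Fintype F] (r : Fin (n + 1) → ℕ) (e : OnePoint F → ℕ) : ℝ :=
  let q : ℝ := Fintype.card F
  let g : ℝ := groupOrder r
  let D : Finset ℕ := (r (Fin.last n)).divisors
  (((g - 1) * (q + g) - ∑ s ∈ D, (s : ℝ) * phiG r s + 1) / (g * (q + g - 1))) ^ mult e 0 *
    (q / (g * (q + g - 1))) ^ mult e (groupOrder r) *
    ∏ s ∈ D.erase 1, ((s : ℝ) * phiG r s / (g * (q + g - 1))) ^ mult e (groupOrder r / s)

end AbelianCovers

end

open AbelianCovers

/-!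
The sum of the characters at a point of `ℙ¹(F)` is a sum over the dual group of `G`, so by
orthogonality it is `0` or the order of an annihilator, and at a rational point `x` it depends only
on the values `f_α(x)`. Being squarefree at `x` depends only on the values and the derivatives of
the `f_α` there. An element of `Fhat` in which no degree is lowered, or a single one, has one of the
ramification types `none`, `some β` at infinity; hence the conditions on it are conditions on this
type, on the constants and on the first order jets of the family `f` at the points of `F`, together
with squarefreeness away from these points.

Given the degrees, all jets are attained by asymptotically the same number of families whose product
is squarefree away from the points of `F`: a squarefree sieve in one polynomial at a time produces
a limiting frequency which, by an invertible substitution in the residue class, is independent of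
the jets, with an error of relative size `q ^ (-m / 2)`. The ratio of the theorem is therefore, up
to this error, the ratio of the weighted numbers of types, constants and jets, and this one is a
product over the points of `ℙ¹(F)`.
-/

noncomputable section

namespace AbelianCovers

open scoped Finset

section ResidueClasses

variable {F : Type*} [Field F] [Fintype F]

/-- The monic polynomials of degree `d` over a finite field. -/
def monics (F : Type*) [Field F] [Fintype F] (d : ℕ) : Finset F[X] :=
  Finset.univ.map (((monicEquivDegreeLT (R := F) d).trans
    (degreeLTEquiv F d).toEquiv).symm.toEmbedding.trans (Function.Embedding.subtype _))

@[simp]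
theorem mem_monics {d : ℕ} {p : F[X]} : p ∈ monics F d ↔ p.Monic ∧ p.natDegree = d := by
  let e := (monicEquivDegreeLT (R := F) d).trans (degreeLTEquiv F d).toEquiv
  simp only [monics, Finset.mem_map, Finset.mem_univ, true_and]
  exact ⟨by rintro ⟨v, rfl⟩; exact (e.symm v).2,
    fun h => ⟨e ⟨p, h⟩, congrArg Subtype.val (e.symm_apply_apply ⟨p, h⟩)⟩⟩

theorem card_monics (d : ℕ) : #(monics F d) = Fintype.card F ^ d := by
  simp [monics]

theorem degree_sub_lt_of_mem_monics {d : ℕ} {f g : F[X]} (hf : f ∈ monics F d)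
    (hg : g ∈ monics F d) : (f - g).degree < d := by
  obtain ⟨hfm, rfl⟩ := mem_monics.1 hf
  obtain ⟨hgm, hgf⟩ := mem_monics.1 hg
  have hdeg : f.degree = g.degree := by
    rw [degree_eq_natDegree hfm.ne_zero, degree_eq_natDegree hgm.ne_zero, hgf]
  exact (degree_sub_lt_left hdeg hfm.ne_zero (hfm.trans hgm.symm)).trans_le degree_le_natDegree

open scoped Classical in
theorem card_monics_filter_dvd_sub {M : F[X]} (hM : M.Monic) (A : F[X]) {d : ℕ}
    (hd : M.natDegree ≤ d) :
    #{f ∈ monics F d | M ∣ f - A} = Fintype.card F ^ (d - M.natDegree) := by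
  have hlt {f : F[X]} (hf : f.Monic) (h : f.natDegree = d) : (A %ₘ M).degree < f.degree :=
    (degree_modByMonic_lt A hM).trans_le <| by
      rw [degree_eq_natDegree hM.ne_zero, degree_eq_natDegree hf.ne_zero, h]
      exact_mod_cast hd
  have hmod : M ∣ A %ₘ M - A := by simp [modByMonic_eq_sub_mul_div]
  rw [← card_monics, eq_comm]
  refine Finset.card_bij (fun g _ => M * g + A %ₘ M) (fun g hg => ?_)
    (fun g _ g' _ h => mul_left_cancel₀ hM.ne_zero (add_right_cancel h)) fun f hf => ?_
  · obtain ⟨hg, hgd⟩ := mem_monics.1 hg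
    have hMg := hM.mul hg
    have hMgd : (M * g).natDegree = d := by rw [hM.natDegree_mul hg]; lia
    refine Finset.mem_filter.2 ⟨mem_monics.2 ⟨hMg.add_of_left (hlt hMg hMgd), ?_⟩, ?_⟩
    · rw [natDegree_add_eq_left_of_degree_lt (hlt hMg hMgd), hMgd]
    · rw [add_sub_assoc]
      exact (dvd_mul_right M g).add hmod
  · simp only [Finset.mem_filter, mem_monics] at hf
    obtain ⟨⟨hf, hfd⟩, hdvd⟩ := hf
    obtain ⟨g, hg⟩ : M ∣ f - A %ₘ M := by
      simpa using hdvd.sub hmod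
    have hMg : (M * g).Monic := hg ▸ hf.sub_of_left (hlt hf hfd)
    have hgm : g.Monic := hM.of_mul_monic_left hMg
    refine ⟨g, mem_monics.2 ⟨hgm, ?_⟩, by rw [← hg, sub_add_cancel]⟩
    have := hM.natDegree_mul hgm
    rw [← hg, natDegree_eq_of_degree_eq (degree_sub_eq_left_of_degree_lt (hlt hf hfd)), hfd] at this
    lia

open scoped Classical in
theorem card_monics_filter_dvd_sub_le_one {M : F[X]} (A : F[X]) {d : ℕ}
    (hd : d ≤ M.natDegree) : #{f ∈ monics F d | M ∣ f - A} ≤ 1 := by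
  refine Finset.card_le_one.2 fun f hf g hg => ?_
  simp only [Finset.mem_filter] at hf hg
  by_contra hne
  have hdvd : M ∣ f - g := by simpa using hf.2.sub hg.2
  have := natDegree_le_of_dvd hdvd (sub_ne_zero.2 hne)
  have := (natDegree_lt_iff_degree_lt (sub_ne_zero.2 hne)).2
    (degree_sub_lt_of_mem_monics hf.1 hg.1)
  lia

theorem exists_dvd_and_dvd_sub_iff {R : Type*} [CommRing R] {M N : R} (h : IsCoprime M N)
    (A : R) : ∃ B, ∀ f, M ∣ f ∧ N ∣ f - A ↔ M * N ∣ f - B := by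
  obtain ⟨u, v, huv⟩ := h
  have hN : N ∣ A - u * M * A := ⟨v * A, by linear_combination -A * huv⟩
  have hM : M ∣ u * M * A := (dvd_mul_left M u).mul_right A
  refine ⟨u * M * A, fun f => ⟨fun ⟨hMf, hNf⟩ => ?_, fun hf => ⟨?_, ?_⟩⟩⟩
  · exact IsCoprime.mul_dvd ⟨u, v, huv⟩ (hMf.sub hM) (by simpa using hNf.add hN)
  · simpa using ((dvd_mul_right M N).trans hf).add hM
  · simpa using ((dvd_mul_left N M).trans hf).sub hN

open scoped Classical in
/-- The number of monic multiples of `M` of degree `d` in the residue class of `A` modulo `N`. -/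
def multipleCount (N M : F[X]) (d : ℕ) (A : F[X]) : ℕ :=
  #{f ∈ monics F d | M ∣ f ∧ N ∣ f - A}

open scoped Classical in
theorem multipleCount_eq_zero {N M : F[X]} {d : ℕ} (hd : d < M.natDegree) (A : F[X]) :
    multipleCount N M d A = 0 := by
  rw [multipleCount, Finset.card_eq_zero, Finset.filter_eq_empty_iff]
  rintro f hf ⟨hdvd, -⟩
  obtain ⟨hfm, rfl⟩ := mem_monics.1 hf
  exact hd.not_ge (natDegree_le_of_dvd hdvd hfm.ne_zero)

open scoped Classical in
theorem abs_multipleCount_succ_sub_le {N M : F[X]} (hN : N.Monic) (hM : M.Monic)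
    (hMN : IsCoprime M N) (d : ℕ) (A B : F[X]) :
    |(multipleCount N M (d + 1) A : ℝ) - Fintype.card F * multipleCount N M d B| ≤
      if M.natDegree ≤ d + 1 then (Fintype.card F : ℝ) else 0 := by
  split_ifs with hdeg
  · obtain ⟨A', hA'⟩ := exists_dvd_and_dvd_sub_iff hMN A
    obtain ⟨B', hB'⟩ := exists_dvd_and_dvd_sub_iff hMN B
    simp only [multipleCount, hA', hB']
    rcases le_or_gt (M * N).natDegree d with h | h
    · rw [card_monics_filter_dvd_sub (hM.mul hN) _ h,
        card_monics_filter_dvd_sub (hM.mul hN) _ (h.trans d.le_succ), Nat.succ_sub h, pow_succ']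
      simp
    · have hq : (1 : ℝ) ≤ Fintype.card F := by exact_mod_cast Fintype.card_pos (α := F)
      have h₁ : (#{f ∈ monics F (d + 1) | M * N ∣ f - A'} : ℝ) ≤ 1 := by
        exact_mod_cast card_monics_filter_dvd_sub_le_one A' h
      have h₂ : (#{f ∈ monics F d | M * N ∣ f - B'} : ℝ) ≤ 1 := by
        exact_mod_cast card_monics_filter_dvd_sub_le_one B' h.le
      exact abs_sub_le_of_nonneg_of_le (by positivity) (h₁.trans hq) (by positivity)
        (mul_le_of_le_one_right (by positivity) h₂)
  · rw [multipleCount_eq_zero (by lia), multipleCount_eq_zero (by lia)]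
    simp

end ResidueClasses

section Limit

theorem exists_forall_abs_sub_le_of_abs_succ_sub_le {X : Type*} {ρ : ℕ → X → ℝ} {C r : ℝ}
    (hr : r < 1) (h : ∀ d x y, |ρ (d + 1) x - ρ d y| ≤ C * r ^ d) :
    ∃ δ, ∀ d x, |ρ d x - δ| ≤ C * r ^ d / (1 - r) := by
  rcases isEmpty_or_nonempty X with hX | ⟨⟨x₀⟩⟩
  · exact ⟨0, fun _ x => hX.elim x⟩
  have hgeom (x : ℕ → X) (n : ℕ) : dist (ρ n (x n)) (ρ (n + 1) (x (n + 1))) ≤ C * r ^ n := by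
    rw [dist_comm, Real.dist_eq]
    exact h n _ _
  obtain ⟨δ, hδ⟩ := cauchySeq_tendsto_of_complete
    (cauchySeq_of_le_geometric r C hr (hgeom fun _ => x₀))
  refine ⟨δ, fun d x => ?_⟩
  -- Redirecting the sequence to `x` at the single time `d` does not change its limit.
  let y : ℕ → X := fun n => if n = d then x else x₀
  have hy : Filter.Tendsto (fun n => ρ n (y n)) Filter.atTop (nhds δ) :=
    hδ.congr' <| (Filter.eventually_gt_atTop d).mono fun n hn => by simp [y, hn.ne']
  simpa [y, Real.dist_eq] using dist_le_of_le_geometric_of_tendsto r C hr (hgeom y) hy d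

end Limit

section DivisorSums

variable {F : Type*} [Field F] [Fintype F]

open scoped Classical in
/-- The monic polynomials of degree at most `n` over a finite field. -/
def monicsUpTo (F : Type*) [Field F] [Fintype F] (n : ℕ) : Finset F[X] :=
  (Finset.range (n + 1)).biUnion (monics F)

@[simp]
theorem mem_monicsUpTo {n : ℕ} {f : F[X]} : f ∈ monicsUpTo F n ↔ f.Monic ∧ f.natDegree ≤ n := by
  simp only [monicsUpTo, Finset.mem_biUnion, Finset.mem_range, mem_monics, Nat.lt_succ_iff]
  exact ⟨by rintro ⟨i, hi, hf, rfl⟩; exact ⟨hf, hi⟩, fun ⟨hf, hn⟩ => ⟨_, hn, hf, rfl⟩⟩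

theorem sum_monicsUpTo {A : Type*} [AddCommMonoid A] (n : ℕ) (g : F[X] → A) :
    ∑ f ∈ monicsUpTo F n, g f = ∑ i ∈ Finset.range (n + 1), ∑ f ∈ monics F i, g f := by
  classical
  refine Finset.sum_biUnion fun i _ j _ hij => Finset.disjoint_left.2 fun f hf hf' => hij ?_
  exact (mem_monics.1 hf).2.symm.trans (mem_monics.1 hf').2

/-- `√q`, where `q` is the cardinality of `F`. -/
def sqrtCard (F : Type*) [Fintype F] : ℝ := √(Fintype.card F)

theorem sqrtCard_sq : sqrtCard F ^ 2 = Fintype.card F := Real.sq_sqrt (by positivity)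

theorem one_lt_sqrtCard : 1 < sqrtCard F := by
  rw [sqrtCard, Real.lt_sqrt zero_le_one, one_pow]
  exact_mod_cast Fintype.one_lt_card (α := F)

theorem sqrtCard_pos : 0 < sqrtCard F := one_pos.trans one_lt_sqrtCard

theorem inv_sqrtCard_pos : 0 < (sqrtCard F)⁻¹ := inv_pos.2 sqrtCard_pos

theorem inv_sqrtCard_lt_one : (sqrtCard F)⁻¹ < 1 := inv_lt_one_of_one_lt₀ one_lt_sqrtCard

theorem card_rpow_neg_div_two (m : ℕ) :
    (Fintype.card F : ℝ) ^ (-(m : ℝ) / 2) = (sqrtCard F)⁻¹ ^ m := by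
  have h : (0 : ℝ) ≤ Fintype.card F := by positivity
  rw [sqrtCard, Real.sqrt_eq_rpow, ← Real.rpow_neg h, ← Real.rpow_natCast, ← Real.rpow_mul h]
  congr 1
  ring

theorem card_monicsUpTo_le (n : ℕ) : #(monicsUpTo F n) ≤ 2 * Fintype.card F ^ n := by
  have hq : 2 ≤ Fintype.card F := Fintype.one_lt_card
  rw [Finset.card_eq_sum_ones, sum_monicsUpTo]
  simp only [← Finset.card_eq_sum_ones, card_monics]
  induction n with
  | zero => simp
  | succ n ih =>
    rw [Finset.sum_range_succ]
    have : 2 * Fintype.card F ^ n ≤ Fintype.card F ^ (n + 1) := by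
      rw [pow_succ']
      exact Nat.mul_le_mul_right _ hq
    lia

open scoped Classical in
theorem card_monicsUpTo_filter_le (e n : ℕ) :
    (#{f ∈ monicsUpTo F n | e + 2 * f.natDegree ≤ n} : ℝ) ≤
      2 * sqrtCard F ^ n * (sqrtCard F)⁻¹ ^ e := by
  have hs := sqrtCard_pos (F := F)
  rcases le_or_gt e n with he | he
  · have hsub : {f ∈ monicsUpTo F n | e + 2 * f.natDegree ≤ n} ⊆ monicsUpTo F ((n - e) / 2) := by
      intro f hf
      simp only [Finset.mem_filter, mem_monicsUpTo] at hf ⊢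
      exact ⟨hf.1.1, by lia⟩
    calc (#{f ∈ monicsUpTo F n | e + 2 * f.natDegree ≤ n} : ℝ)
        ≤ 2 * (Fintype.card F : ℝ) ^ ((n - e) / 2) := by
          exact_mod_cast (Finset.card_le_card hsub).trans (card_monicsUpTo_le _)
      _ = 2 * sqrtCard F ^ (2 * ((n - e) / 2)) := by rw [pow_mul, sqrtCard_sq]
      _ ≤ 2 * sqrtCard F ^ (n - e) := by
          gcongr
          exacts [one_lt_sqrtCard.le, by lia]
      _ = 2 * sqrtCard F ^ n * (sqrtCard F)⁻¹ ^ e := by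
          rw [pow_sub₀ _ hs.ne' he, inv_pow, mul_assoc]
  · rw [Finset.filter_false_of_mem fun f _ => by lia]
    simp only [Finset.card_empty, Nat.cast_zero]
    positivity

open scoped Classical in
/-- The monic divisors of a non-zero polynomial. -/
def monicDivisors (H : F[X]) : Finset F[X] := {E ∈ monicsUpTo F H.natDegree | E ∣ H}

theorem mem_monicDivisors {H E : F[X]} (hH : H ≠ 0) :
    E ∈ monicDivisors H ↔ E.Monic ∧ E ∣ H := by
  simp only [monicDivisors, Finset.mem_filter, mem_monicsUpTo]
  exact ⟨fun h => ⟨h.1.1, h.2⟩, fun h => ⟨⟨h.1, natDegree_le_of_dvd h.2 hH⟩, h.2⟩⟩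

/-- The divisor sum `∑ q ^ (-deg E / 2)` over the monic divisors `E` of `H`. -/
def divSum (H : F[X]) : ℝ := ∑ E ∈ monicDivisors H, (sqrtCard F)⁻¹ ^ E.natDegree

theorem divSum_nonneg (H : F[X]) : 0 ≤ divSum H :=
  Finset.sum_nonneg fun _ _ => pow_nonneg inv_sqrtCard_pos.le _

theorem divSum_one : divSum (1 : F[X]) = 1 := by
  have : monicDivisors (1 : F[X]) = {1} := by
    ext E
    rw [mem_monicDivisors one_ne_zero, Finset.mem_singleton]
    exact ⟨fun h => h.1.eq_one_of_isUnit (isUnit_of_dvd_one h.2), by rintro rfl; simp⟩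
  simp [divSum, this]

theorem divSum_mul_le {H K : F[X]} (hH : H ≠ 0) (hK : K ≠ 0) :
    divSum (H * K) ≤ divSum H * divSum K := by
  classical
  have hsub : monicDivisors (H * K) ⊆
      (monicDivisors H ×ˢ monicDivisors K).image fun p => p.1 * p.2 := by
    intro E hE
    obtain ⟨hm, hd⟩ := (mem_monicDivisors (mul_ne_zero hH hK)).1 hE
    obtain ⟨A, B, hA, hB, rfl⟩ := exists_dvd_and_dvd_of_dvd_mul hd
    refine Finset.mem_image.2 ⟨(normalize A, normalize B), Finset.mem_product.2
      ⟨(mem_monicDivisors hH).2 ⟨monic_normalize (left_ne_zero_of_mul hm.ne_zero), ?_⟩,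
      (mem_monicDivisors hK).2 ⟨monic_normalize (right_ne_zero_of_mul hm.ne_zero), ?_⟩⟩, ?_⟩
    · exact normalize_dvd_iff.2 hA
    · exact normalize_dvd_iff.2 hB
    · rw [← normalize_mul, hm.normalize_eq_self]
  have hpos (E : F[X]) : 0 ≤ (sqrtCard F)⁻¹ ^ E.natDegree := pow_nonneg inv_sqrtCard_pos.le _
  calc divSum (H * K)
      ≤ ∑ p ∈ monicDivisors H ×ˢ monicDivisors K, (sqrtCard F)⁻¹ ^ (p.1 * p.2).natDegree :=
        (Finset.sum_le_sum_of_subset_of_nonneg hsub fun E _ _ => hpos E).trans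
          (Finset.sum_image_le_of_nonneg fun E _ => hpos _)
    _ = divSum H * divSum K := by
        rw [divSum, divSum, Finset.sum_mul_sum, ← Finset.sum_product']
        refine Finset.sum_congr rfl fun p hp => ?_
        rw [Finset.mem_product, mem_monicDivisors hH, mem_monicDivisors hK] at hp
        rw [hp.1.1.natDegree_mul hp.2.1, pow_add]

theorem divSum_prod_le {ι : Type*} (s : Finset ι) (f : ι → F[X]) (hf : ∀ i ∈ s, f i ≠ 0) :
    divSum (∏ i ∈ s, f i) ≤ ∏ i ∈ s, divSum (f i) := by
  classical
  induction s using Finset.induction_on with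
  | empty => simp [divSum_one]
  | insert i s hi ih =>
    simp only [Finset.forall_mem_insert] at hf
    rw [Finset.prod_insert hi, Finset.prod_insert hi]
    exact (divSum_mul_le hf.1 (Finset.prod_ne_zero_iff.2 hf.2)).trans
      (mul_le_mul_of_nonneg_left (ih hf.2) (divSum_nonneg _))

theorem sum_monics_divSum (d : ℕ) : ∑ f ∈ monics F d, divSum f =
    (∑ e ∈ Finset.range (d + 1), (sqrtCard F)⁻¹ ^ e) * (Fintype.card F : ℝ) ^ d := by
  classical
  have hdivSum : ∀ f ∈ monics F d, divSum f = ∑ E ∈ monicsUpTo F d,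
      if E ∣ f then (sqrtCard F)⁻¹ ^ E.natDegree else 0 := fun f hf => by
    rw [divSum, monicDivisors, (mem_monics.1 hf).2, Finset.sum_filter]
  have hcount (e : ℕ) (he : e ≤ d) (E : F[X]) (hE : E ∈ monics F e) :
      (#{f ∈ monics F d | E ∣ f} : ℝ) = (Fintype.card F : ℝ) ^ (d - e) := by
    obtain ⟨hEm, rfl⟩ := mem_monics.1 hE
    exact_mod_cast by simpa using card_monics_filter_dvd_sub hEm 0 he
  rw [Finset.sum_congr rfl hdivSum, Finset.sum_comm, sum_monicsUpTo, Finset.sum_mul]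
  refine Finset.sum_congr rfl fun e he => ?_
  have hed : e ≤ d := Nat.lt_succ_iff.1 (Finset.mem_range.1 he)
  calc ∑ E ∈ monics F e, ∑ f ∈ monics F d, (if E ∣ f then (sqrtCard F)⁻¹ ^ E.natDegree else 0)
      = ∑ _E ∈ monics F e, (Fintype.card F : ℝ) ^ (d - e) * (sqrtCard F)⁻¹ ^ e := by
        refine Finset.sum_congr rfl fun E hE => ?_
        rw [← Finset.sum_filter, Finset.sum_const, nsmul_eq_mul, hcount e hed E hE,
          (mem_monics.1 hE).2]
    _ = (sqrtCard F)⁻¹ ^ e * (Fintype.card F : ℝ) ^ d := by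
        rw [Finset.sum_const, card_monics, nsmul_eq_mul, ← mul_assoc, Nat.cast_pow, ← pow_add,
          Nat.add_sub_cancel' hed, mul_comm]

theorem sum_monics_divSum_le (d : ℕ) :
    ∑ f ∈ monics F d, divSum f ≤ (1 - (sqrtCard F)⁻¹)⁻¹ * (Fintype.card F : ℝ) ^ d := by
  rw [sum_monics_divSum, ← tsum_geometric_of_lt_one inv_sqrtCard_pos.le inv_sqrtCard_lt_one]
  gcongr
  exact (summable_geometric_of_lt_one inv_sqrtCard_pos.le inv_sqrtCard_lt_one).sum_le_tsum _
    fun _ _ => pow_nonneg inv_sqrtCard_pos.le _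

end DivisorSums

section Sieve

theorem ite_forall_not_eq_sum_powerset {ι R : Type*} [CommRing R] (s : Finset ι) (p : ι → Prop)
    [DecidablePred p] :
    (if ∀ i ∈ s, ¬p i then (1 : R) else 0) =
      ∑ t ∈ s.powerset, (-1) ^ #t * if ∀ i ∈ t, p i then 1 else 0 := by
  calc (if ∀ i ∈ s, ¬p i then (1 : R) else 0) = ∏ i ∈ s, (1 + -if p i then 1 else 0) := by
        rw [← Finset.prod_const_one (s := s), ← Finset.prod_ite_zero]
        exact Finset.prod_congr rfl fun i _ => by split_ifs <;> simp_all
    _ = ∑ t ∈ s.powerset, (-1) ^ #t * if ∀ i ∈ t, p i then 1 else 0 := by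
        rw [Finset.prod_one_add]
        simp only [Finset.prod_neg, Finset.prod_ite_zero, Finset.prod_const_one]

section Prime

variable {K : Type*} [Field K]

theorem isCoprime_of_monic_of_irreducible {P Q : K[X]} (hP : P.Monic) (hP' : Irreducible P)
    (hQ : Q.Monic) (hQ' : Irreducible Q) (h : P ≠ Q) : IsCoprime P Q :=
  hP'.coprime_iff_not_dvd.2 fun h' =>
    h (eq_of_monic_of_associated hP hQ (hP'.associated_of_dvd hQ' h'))

theorem mem_iff_dvd_prod_of_irreducible {T : Finset K[X]}
    (hT : ∀ Q ∈ T, Q.Monic ∧ Irreducible Q) {P : K[X]} (hP : P.Monic) (hP' : Irreducible P) :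
    P ∈ T ↔ P ∣ ∏ Q ∈ T, Q := by
  refine ⟨fun h => Finset.dvd_prod_of_mem (fun Q => Q) h, fun h => ?_⟩
  obtain ⟨Q, hQ, hPQ⟩ := (hP'.prime.dvd_finsetProd_iff _).1 h
  rwa [eq_of_monic_of_associated hP (hT Q hQ).1 (hP'.associated_of_dvd (hT Q hQ).2 hPQ)]

theorem injOn_prod_of_irreducible :
    Set.InjOn (fun T : Finset K[X] => ∏ P ∈ T, P) {T | ∀ P ∈ T, P.Monic ∧ Irreducible P} := by
  intro T hT T' hT' (h : ∏ P ∈ T, P = ∏ P ∈ T', P)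
  ext P
  refine ⟨fun hP => ?_, fun hP => ?_⟩
  · obtain ⟨hPm, hPi⟩ := hT P hP
    rwa [mem_iff_dvd_prod_of_irreducible hT' hPm hPi, ← h,
      ← mem_iff_dvd_prod_of_irreducible hT hPm hPi]
  · obtain ⟨hPm, hPi⟩ := hT' P hP
    rwa [mem_iff_dvd_prod_of_irreducible hT hPm hPi, h,
      ← mem_iff_dvd_prod_of_irreducible hT' hPm hPi]

theorem prod_dvd_of_irreducible {T : Finset K[X]} (hT : ∀ P ∈ T, P.Monic ∧ Irreducible P)
    {f : K[X]} (hf : ∀ P ∈ T, P ∣ f) : ∏ P ∈ T, P ∣ f :=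
  Finset.prod_dvd_of_coprime (fun P hP Q hQ hPQ => isCoprime_of_monic_of_irreducible
    (hT P hP).1 (hT P hP).2 (hT Q hQ).1 (hT Q hQ).2 hPQ) hf

/-- No square of a prime outside `N` divides `f`. -/
def SquarefreeAway (N f : K[X]) : Prop :=
  ∀ P : K[X], P.Monic → Irreducible P → ¬P ∣ N → ¬P ^ 2 ∣ f

open scoped Classical in
/-- The power of the prime `P` by which `f` must not be divisible if `f * H` is to be free of the
square of `P`, given that `H` is. -/
def excluded (H P : K[X]) : K[X] := if P ∣ H then P else P ^ 2

theorem monic_excluded (H : K[X]) {P : K[X]} (hP : P.Monic) : (excluded H P).Monic := by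
  unfold excluded
  split_ifs
  exacts [hP, hP.pow 2]

theorem isCoprime_excluded_left {H P Q : K[X]} (h : IsCoprime P Q) :
    IsCoprime (excluded H P) Q := by
  unfold excluded
  split_ifs
  exacts [h, h.pow_left]

theorem SquarefreeAway.mul_iff {N H : K[X]} (hH : SquarefreeAway N H) (f : K[X]) :
    SquarefreeAway N (f * H) ↔
      ∀ P : K[X], P.Monic → Irreducible P → ¬P ∣ N → ¬excluded H P ∣ f := by
  refine forall₄_congr fun P hP hP' hPN => not_congr ?_
  unfold excluded
  split_ifs with hPH
  · refine ⟨fun h => by_contra fun hPf => ?_, fun h => ?_⟩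
    · exact hH P hP hP' hPN (hP'.prime.pow_dvd_of_dvd_mul_left 2 hPf h)
    · rw [pow_two]
      exact mul_dvd_mul h hPH
  · exact ⟨hP'.prime.pow_dvd_of_dvd_mul_right 2 hPH, fun h => h.mul_right H⟩

open scoped Classical in
theorem prod_excluded (H : K[X]) (T : Finset K[X]) :
    ∏ P ∈ T, excluded H P = (∏ P ∈ T with P ∣ H, P) * (∏ P ∈ T with ¬P ∣ H, P) ^ 2 := by
  simp only [excluded, Finset.prod_ite, Finset.prod_pow]

end Prime

variable {F : Type*} [Field F] [Fintype F]

open scoped Classical in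
/-- The primes outside `N` of degree at most `n`. -/
def primesAway (N : F[X]) (n : ℕ) : Finset F[X] :=
  {P ∈ monicsUpTo F n | Irreducible P ∧ ¬P ∣ N}

theorem mem_primesAway {N P : F[X]} {n : ℕ} :
    P ∈ primesAway N n ↔ P.Monic ∧ Irreducible P ∧ P.natDegree ≤ n ∧ ¬P ∣ N := by
  simp only [primesAway, Finset.mem_filter, mem_monicsUpTo]
  tauto

theorem SquarefreeAway.mul_iff_forall_primesAway {N H f : F[X]} (hH : SquarefreeAway N H)
    (hf : f ≠ 0) {n : ℕ} (hn : f.natDegree ≤ n) :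
    SquarefreeAway N (f * H) ↔ ∀ P ∈ primesAway N n, ¬excluded H P ∣ f := by
  have hdvd (P : F[X]) : P ∣ excluded H P := by
    unfold excluded
    split_ifs
    exacts [dvd_rfl, dvd_pow_self P two_ne_zero]
  simp only [hH.mul_iff, mem_primesAway]
  refine ⟨fun h P hP => h P hP.1 hP.2.1 hP.2.2.2, fun h P hP hP' hPN hPf => ?_⟩
  exact h P ⟨hP, hP', (natDegree_le_of_dvd ((hdvd P).trans hPf) hf).trans hn, hPN⟩ hPf

theorem prod_excluded_dvd_iff {N : F[X]} {n : ℕ} {T : Finset F[X]} (hT : T ⊆ primesAway N n)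
    (H f : F[X]) : ∏ P ∈ T, excluded H P ∣ f ↔ ∀ P ∈ T, excluded H P ∣ f := by
  refine ⟨fun h P hP => (Finset.dvd_prod_of_mem _ hP).trans h,
    Finset.prod_dvd_of_coprime fun P hP Q hQ hPQ => ?_⟩
  obtain ⟨hP₁, hP₂, -⟩ := mem_primesAway.1 (hT hP)
  obtain ⟨hQ₁, hQ₂, -⟩ := mem_primesAway.1 (hT hQ)
  exact isCoprime_excluded_left
    (isCoprime_excluded_left (isCoprime_of_monic_of_irreducible hP₁ hP₂ hQ₁ hQ₂ hPQ).symm).symm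

open scoped Classical in
theorem card_powerset_filter_natDegree_prod_excluded_le {H : F[X]} (hH : H ≠ 0) (N : F[X])
    (n : ℕ) : (#{T ∈ (primesAway N n).powerset | (∏ P ∈ T, excluded H P).natDegree ≤ n} : ℝ) ≤
      2 * sqrtCard F ^ n * divSum H := by
  have hprime {T : Finset F[X]} (hT : T ⊆ primesAway N n) : ∀ P ∈ T, P.Monic ∧ Irreducible P :=
    fun P hP => ⟨(mem_primesAway.1 (hT hP)).1, (mem_primesAway.1 (hT hP)).2.1⟩
  -- `T` is determined by the product `E ∣ H` of its members dividing `H` and the product `D` of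
  -- the other ones, and `∏ P ∈ T, excluded H P = E * D ^ 2`.
  have hcard : #{T ∈ (primesAway N n).powerset | (∏ P ∈ T, excluded H P).natDegree ≤ n} ≤
      #((monicDivisors H).sigma fun E =>
        {D ∈ monicsUpTo F n | E.natDegree + 2 * D.natDegree ≤ n}) := by
    refine Finset.card_le_card_of_injOn
      (fun T => ⟨∏ P ∈ T with P ∣ H, P, ∏ P ∈ T with ¬P ∣ H, P⟩) (fun T hT => ?_) ?_
    · obtain ⟨hTp, hdeg⟩ := Finset.mem_filter.1 hT
      have hTp := hprime (Finset.mem_powerset.1 hTp)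
      have hmonic (p : F[X] → Prop) [DecidablePred p] : (∏ P ∈ T with p P, P).Monic :=
        monic_prod_of_monic _ _ fun P hP => (hTp P (Finset.mem_filter.1 hP).1).1
      rw [prod_excluded, (hmonic _).natDegree_mul ((hmonic _).pow 2),
        (hmonic _).natDegree_pow] at hdeg
      have hdvd : ∏ P ∈ T with P ∣ H, P ∣ H :=
        prod_dvd_of_irreducible (fun P hP => hTp P (Finset.mem_filter.1 hP).1)
          fun P hP => (Finset.mem_filter.1 hP).2
      simp only [Finset.mem_coe, Finset.mem_sigma, mem_monicDivisors hH, Finset.mem_filter,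
        mem_monicsUpTo]
      exact ⟨⟨hmonic _, hdvd⟩, ⟨hmonic _, by lia⟩, hdeg⟩
    · intro T hT T' hT' h
      simp only [Sigma.mk.injEq, heq_eq_eq] at h
      refine injOn_prod_of_irreducible (hprime (Finset.mem_powerset.1 (Finset.mem_filter.1 hT).1))
        (hprime (Finset.mem_powerset.1 (Finset.mem_filter.1 hT').1)) ?_
      simp only
      rw [← Finset.prod_filter_mul_prod_filter_not T (· ∣ H), h.1, h.2,
        Finset.prod_filter_mul_prod_filter_not]
  refine (Nat.cast_le.2 hcard).trans ?_
  rw [Finset.card_sigma, divSum, Finset.mul_sum, Nat.cast_sum]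
  exact Finset.sum_le_sum fun E _ => card_monicsUpTo_filter_le _ n

open scoped Classical in
/-- The number of monic `f` of degree `d` in the residue class of `A` modulo `N` such that
`f * H` is squarefree away from `N`. -/
def sieveCount (N H : F[X]) (d : ℕ) (A : F[X]) : ℕ :=
  #{f ∈ monics F d | SquarefreeAway N (f * H) ∧ N ∣ f - A}

theorem sieveCount_eq_sum {N H : F[X]} (hH : SquarefreeAway N H) {d n : ℕ} (hdn : d ≤ n)
    (A : F[X]) : (sieveCount N H d A : ℝ) = ∑ T ∈ (primesAway N n).powerset,
      (-1) ^ #T * (multipleCount N (∏ P ∈ T, excluded H P) d A : ℝ) := by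
  classical
  have hite : ∀ f ∈ monics F d, (if SquarefreeAway N (f * H) ∧ N ∣ f - A then (1 : ℝ) else 0) =
      ∑ T ∈ (primesAway N n).powerset,
        (-1) ^ #T * if (∏ P ∈ T, excluded H P) ∣ f ∧ N ∣ f - A then (1 : ℝ) else 0 := by
    intro f hf
    obtain ⟨hfm, rfl⟩ := mem_monics.1 hf
    by_cases hA : N ∣ f - A
    · simp only [hA, and_true, hH.mul_iff_forall_primesAway hfm.ne_zero hdn]
      rw [ite_forall_not_eq_sum_powerset]
      refine Finset.sum_congr rfl fun T hT => ?_
      simp only [prod_excluded_dvd_iff (Finset.mem_powerset.1 hT)]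
    · simp [hA]
  rw [sieveCount, ← Finset.sum_boole, Finset.sum_congr rfl hite, Finset.sum_comm]
  refine Finset.sum_congr rfl fun T _ => ?_
  rw [← Finset.mul_sum, Finset.sum_boole, multipleCount]

theorem isCoprime_prod_excluded {N : F[X]} {n : ℕ} {T : Finset F[X]} (hT : T ⊆ primesAway N n)
    (H : F[X]) : IsCoprime (∏ P ∈ T, excluded H P) N :=
  IsCoprime.prod_left fun _ hP =>
    have hP := mem_primesAway.1 (hT hP)
    isCoprime_excluded_left (hP.2.1.coprime_iff_not_dvd.2 hP.2.2.2)

theorem abs_sieveCount_succ_sub_le {N H : F[X]} (hN : N.Monic) (hH₀ : H ≠ 0)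
    (hH : SquarefreeAway N H) (d : ℕ) (A B : F[X]) :
    |(sieveCount N H (d + 1) A : ℝ) - Fintype.card F * sieveCount N H d B| ≤
      2 * sqrtCard F ^ (d + 1) * divSum H * Fintype.card F := by
  classical
  rw [sieveCount_eq_sum hH le_rfl, sieveCount_eq_sum hH d.le_succ, Finset.mul_sum,
    ← Finset.sum_sub_distrib]
  have hterm : ∀ T ∈ (primesAway N (d + 1)).powerset,
      |(-1) ^ #T * (multipleCount N (∏ P ∈ T, excluded H P) (d + 1) A : ℝ) -
        Fintype.card F * ((-1) ^ #T * multipleCount N (∏ P ∈ T, excluded H P) d B)| ≤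
      if (∏ P ∈ T, excluded H P).natDegree ≤ d + 1 then (Fintype.card F : ℝ) else 0 := by
    intro T hT
    rw [Finset.mem_powerset] at hT
    rw [mul_left_comm, ← mul_sub, abs_mul, abs_pow, abs_neg, abs_one, one_pow, one_mul]
    exact abs_multipleCount_succ_sub_le hN
      (monic_prod_of_monic _ _ fun P hP => monic_excluded H (mem_primesAway.1 (hT hP)).1)
      (isCoprime_prod_excluded hT H) d A B
  refine (Finset.abs_sum_le_sum_abs _ _).trans ((Finset.sum_le_sum hterm).trans ?_)
  rw [← Finset.sum_filter, Finset.sum_const, nsmul_eq_mul]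
  gcongr
  exact card_powerset_filter_natDegree_prod_excluded_le hH₀ N (d + 1)

/-- The constant of the error term in the one variable sieve. -/
def sieveConst (F : Type*) [Fintype F] : ℝ := 2 * sqrtCard F / (1 - (sqrtCard F)⁻¹)

theorem sieveConst_nonneg : 0 ≤ sieveConst F :=
  div_nonneg (mul_nonneg zero_le_two sqrtCard_pos.le) (sub_nonneg.2 inv_sqrtCard_lt_one.le)

theorem exists_abs_sieveCount_div_sub_le {N H : F[X]} (hN : N.Monic) (hH₀ : H ≠ 0)
    (hH : SquarefreeAway N H) : ∃ δ : ℝ, ∀ d A,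
      |(sieveCount N H d A : ℝ) / Fintype.card F ^ d - δ| ≤
        sieveConst F * divSum H * (sqrtCard F)⁻¹ ^ d := by
  have hs := sqrtCard_pos (F := F)
  have hstep (d : ℕ) (A B : F[X]) :
      |(sieveCount N H (d + 1) A : ℝ) / Fintype.card F ^ (d + 1) -
        sieveCount N H d B / Fintype.card F ^ d| ≤
      2 * sqrtCard F * divSum H * (sqrtCard F)⁻¹ ^ d := by
    have hq : (0 : ℝ) < Fintype.card F := by exact_mod_cast Fintype.card_pos
    have hdiv : (sieveCount N H (d + 1) A : ℝ) / Fintype.card F ^ (d + 1) -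
        sieveCount N H d B / Fintype.card F ^ d =
        (sieveCount N H (d + 1) A - Fintype.card F * sieveCount N H d B) /
          Fintype.card F ^ (d + 1) := by
      rw [pow_succ', sub_div, mul_div_mul_left _ _ hq.ne']
    rw [hdiv, abs_div, abs_of_pos (pow_pos hq _), div_le_iff₀ (pow_pos hq _)]
    refine (abs_sieveCount_succ_sub_le hN hH₀ hH d A B).trans_eq ?_
    rw [← sqrtCard_sq, inv_pow]
    field_simp
    ring
  obtain ⟨δ, hδ⟩ := exists_forall_abs_sub_le_of_abs_succ_sub_le
    (ρ := fun d A => (sieveCount N H d A : ℝ) / Fintype.card F ^ d) inv_sqrtCard_lt_one hstep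
  refine ⟨δ, fun d A => (hδ d A).trans_eq ?_⟩
  rw [sieveConst]
  ring

theorem abs_sieveCount_div_sub_sieveCount_div_le {N H : F[X]} (hN : N.Monic) (hH₀ : H ≠ 0)
    (hH : SquarefreeAway N H) (d e : ℕ) (A B : F[X]) :
    |(sieveCount N H d A : ℝ) / Fintype.card F ^ d - sieveCount N H e B / Fintype.card F ^ e| ≤
      sieveConst F * divSum H * ((sqrtCard F)⁻¹ ^ d + (sqrtCard F)⁻¹ ^ e) := by
  obtain ⟨δ, hδ⟩ := exists_abs_sieveCount_div_sub_le hN hH₀ hH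
  rw [mul_add]
  refine (abs_sub_le _ δ _).trans (add_le_add (hδ d A) ?_)
  rw [abs_sub_comm]
  exact hδ e B

end Sieve

section Tuples

@[to_additive]
theorem mul_prod_update_one {ι M : Type*} [Fintype ι] [DecidableEq ι] [CommMonoid M] (f : ι → M)
    (α : ι) : f α * ∏ β, Function.update f α 1 β = ∏ β, f β := by
  rw [Finset.prod_update_of_mem (Finset.mem_univ α), one_mul, Finset.sdiff_singleton_eq_erase,
    Finset.mul_prod_erase _ _ (Finset.mem_univ α)]

theorem SquarefreeAway.of_dvd {K : Type*} [Field K] {N f g : K[X]} (hf : SquarefreeAway N f)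
    (h : g ∣ f) : SquarefreeAway N g :=
  fun P hP hP' hPN hPg => hf P hP hP' hPN (hPg.trans h)

variable {F : Type*} [Field F] [Fintype F] {ι : Type*} [Fintype ι] [DecidableEq ι]

/-- The tuples of monic polynomials of degrees `d`. -/
def tuples (F : Type*) [Field F] [Fintype F] (d : ι → ℕ) : Finset (ι → F[X]) :=
  Fintype.piFinset fun α => monics F (d α)

@[simp]
theorem mem_tuples {d : ι → ℕ} {f : ι → F[X]} :
    f ∈ tuples F d ↔ ∀ α, (f α).Monic ∧ (f α).natDegree = d α := by
  simp [tuples]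

theorem card_tuples (d : ι → ℕ) : #(tuples F d) = Fintype.card F ^ ∑ α, d α := by
  simp only [tuples, Fintype.card_piFinset, card_monics, Finset.prod_pow_eq_pow_sum]

theorem sum_tuples_divSum_prod_le (d : ι → ℕ) : ∑ f ∈ tuples F d, divSum (∏ α, f α) ≤
    (1 - (sqrtCard F)⁻¹)⁻¹ ^ Fintype.card ι * (Fintype.card F : ℝ) ^ ∑ α, d α := by
  calc ∑ f ∈ tuples F d, divSum (∏ α, f α) ≤ ∑ f ∈ tuples F d, ∏ α, divSum (f α) :=
        Finset.sum_le_sum fun f hf =>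
          divSum_prod_le _ _ fun α _ => (mem_tuples.1 hf α).1.ne_zero
    _ = ∏ α, ∑ f ∈ monics F (d α), divSum f := (Finset.prod_univ_sum _ _).symm
    _ ≤ ∏ α, (1 - (sqrtCard F)⁻¹)⁻¹ * (Fintype.card F : ℝ) ^ d α :=
        Finset.prod_le_prod (fun α _ => Finset.sum_nonneg fun f _ => divSum_nonneg f)
          fun α _ => sum_monics_divSum_le (d α)
    _ = _ := by
        rw [Finset.prod_mul_distrib, Finset.prod_const, Finset.card_univ,
          Finset.prod_pow_eq_pow_sum]

open scoped Classical in
/-- The number of tuples of monic polynomials of degrees `d`, in the residue classes of `A`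
modulo `N`, whose product is squarefree away from `N`. -/
def tupleCount (N : F[X]) (d : ι → ℕ) (A : ι → F[X]) : ℕ :=
  #{f ∈ tuples F d | SquarefreeAway N (∏ α, f α) ∧ ∀ α, N ∣ f α - A α}

/-- The proportion of the tuples counted by `tupleCount` among all tuples of degrees `d`. -/
def tupleFreq (N : F[X]) (d : ι → ℕ) (A : ι → F[X]) : ℝ :=
  tupleCount N d A / Fintype.card F ^ ∑ α, d α

open scoped Classical in
/-- The tuples with entry `1` at `α` to which a polynomial at `α` is added in `tupleCount`. -/
def tuplesOff (N : F[X]) (α : ι) (d : ι → ℕ) (A : ι → F[X]) : Finset (ι → F[X]) :=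
  {g ∈ tuples F (Function.update d α 0) |
    SquarefreeAway N (∏ β, g β) ∧ ∀ β, β ≠ α → N ∣ g β - A β}

theorem mem_tuplesOff {N : F[X]} {α : ι} {d : ι → ℕ} {A g : ι → F[X]} :
    g ∈ tuplesOff N α d A ↔ g ∈ tuples F (Function.update d α 0) ∧
      SquarefreeAway N (∏ β, g β) ∧ ∀ β, β ≠ α → N ∣ g β - A β := by
  classical exact Finset.mem_filter

theorem tuplesOff_update (N : F[X]) (α : ι) (d : ι → ℕ) (A : ι → F[X]) (k : ℕ) (B : F[X]) :
    tuplesOff N α (Function.update d α k) (Function.update A α B) = tuplesOff N α d A := by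
  ext g
  simp only [mem_tuplesOff, Function.update_idem]
  exact and_congr_right' (and_congr_right' (forall₂_congr fun β hβ => by
    rw [Function.update_of_ne hβ]))

theorem tupleCount_eq_sum (N : F[X]) (α : ι) (d : ι → ℕ) (A : ι → F[X]) :
    tupleCount N d A =
      ∑ g ∈ tuplesOff N α d A, sieveCount N (∏ β, g β) (d α) (A α) := by
  classical
  simp only [sieveCount, tupleCount]
  rw [← Finset.card_sigma]
  refine Finset.card_bij' (fun f _ => ⟨Function.update f α 1, f α⟩)
    (fun gp _ => Function.update gp.1 α gp.2) (fun f hf => ?_) (fun ⟨g, p⟩ hgp => ?_)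
    (fun f _ => by simp) fun ⟨g, p⟩ hgp => ?_
  · simp only [Finset.mem_filter, mem_tuples] at hf
    obtain ⟨hfd, hsq, hA⟩ := hf
    rw [← mul_prod_update_one f α] at hsq
    simp only [tuplesOff, Finset.mem_sigma, Finset.mem_filter, mem_tuples, mem_monics]
    refine ⟨⟨fun β => ?_, hsq.of_dvd (dvd_mul_left _ _), fun β hβ => ?_⟩, hfd α, hsq, hA α⟩
    · rcases eq_or_ne β α with rfl | hβ
      · simp
      · simpa [hβ] using hfd β
    · simpa [hβ] using hA β
  all_goals
    simp only [tuplesOff, Finset.mem_sigma, Finset.mem_filter, mem_tuples, mem_monics] at hgp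
    obtain ⟨⟨hgd, -, hA⟩, hp, hsq', hAα⟩ := hgp
    have hg₁ : g α = 1 := by simpa using (hgd α).1.natDegree_eq_zero.1 (by simpa using (hgd α).2)
    have hg : Function.update g α 1 = g := by rw [← hg₁, Function.update_eq_self]
  · simp only [Finset.mem_filter, mem_tuples]
    refine ⟨fun β => ?_, ?_, fun β => ?_⟩
    · rcases eq_or_ne β α with rfl | hβ
      · simpa using hp
      · simpa [hβ] using hgd β
    · rw [← mul_prod_update_one _ α]
      simpa [hg] using hsq'
    · rcases eq_or_ne β α with rfl | hβ
      · simpa using hAα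
      · simpa [hβ] using hA β hβ
  · simp [hg]

/-- The constant of the error term for a change of one coordinate in `tupleFreq`. -/
def tupleConst (F ι : Type*) [Fintype F] [Fintype ι] : ℝ :=
  sieveConst F * (1 - (sqrtCard F)⁻¹)⁻¹ ^ Fintype.card ι

theorem tupleFreq_eq_sum (N : F[X]) (α : ι) (d : ι → ℕ) (A : ι → F[X]) :
    tupleFreq N d A = (∑ g ∈ tuplesOff N α d A,
      (sieveCount N (∏ β, g β) (d α) (A α) : ℝ) / Fintype.card F ^ d α) /
        Fintype.card F ^ ∑ β, Function.update d α 0 β := by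
  rw [tupleFreq, tupleCount_eq_sum N α, ← add_sum_update_zero d α, pow_add, Nat.cast_sum,
    ← Finset.sum_div, div_div]

theorem abs_tupleFreq_sub_update_le {N : F[X]} (hN : N.Monic) (d : ι → ℕ) (A : ι → F[X])
    (α : ι) (k : ℕ) (B : F[X]) :
    |tupleFreq N d A - tupleFreq N (Function.update d α k) (Function.update A α B)| ≤
      tupleConst F ι * ((sqrtCard F)⁻¹ ^ d α + (sqrtCard F)⁻¹ ^ k) := by
  have hq : (0 : ℝ) < Fintype.card F ^ ∑ β, Function.update d α 0 β :=
    pow_pos (Nat.cast_pos.2 Fintype.card_pos) _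
  rw [tupleFreq_eq_sum N α, tupleFreq_eq_sum N α (Function.update d α k), tuplesOff_update,
    Function.update_idem, Function.update_self, Function.update_self, ← sub_div,
    ← Finset.sum_sub_distrib, abs_div, abs_of_pos hq, div_le_iff₀ hq]
  have hdiff : ∀ g ∈ tuplesOff N α d A,
      |(sieveCount N (∏ β, g β) (d α) (A α) : ℝ) / Fintype.card F ^ d α -
        sieveCount N (∏ β, g β) k B / Fintype.card F ^ k| ≤
      sieveConst F * divSum (∏ β, g β) * ((sqrtCard F)⁻¹ ^ d α + (sqrtCard F)⁻¹ ^ k) := by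
    intro g hg
    obtain ⟨hgd, hsq, -⟩ := mem_tuplesOff.1 hg
    exact abs_sieveCount_div_sub_sieveCount_div_le hN
      (Finset.prod_ne_zero_iff.2 fun β _ => (mem_tuples.1 hgd β).1.ne_zero) hsq _ _ _ _
  have hs := (inv_sqrtCard_pos (F := F)).le
  have hC := sieveConst_nonneg (F := F)
  refine (Finset.abs_sum_le_sum_abs _ _).trans ?_
  calc _ ≤ ∑ g ∈ tuplesOff N α d A, sieveConst F * divSum (∏ β, g β) *
          ((sqrtCard F)⁻¹ ^ d α + (sqrtCard F)⁻¹ ^ k) :=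
        Finset.sum_le_sum hdiff
    _ ≤ ∑ g ∈ tuples F (Function.update d α 0), sieveConst F * divSum (∏ β, g β) *
          ((sqrtCard F)⁻¹ ^ d α + (sqrtCard F)⁻¹ ^ k) :=
        Finset.sum_le_sum_of_subset_of_nonneg (fun g hg => (mem_tuplesOff.1 hg).1) fun g _ _ =>
          mul_nonneg (mul_nonneg hC (divSum_nonneg _)) (by positivity)
    _ ≤ sieveConst F * ((1 - (sqrtCard F)⁻¹)⁻¹ ^ Fintype.card ι *
          (Fintype.card F : ℝ) ^ ∑ β, Function.update d α 0 β) *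
          ((sqrtCard F)⁻¹ ^ d α + (sqrtCard F)⁻¹ ^ k) := by
        rw [← Finset.sum_mul, ← Finset.mul_sum]
        gcongr
        exact sum_tuples_divSum_prod_le _
    _ = _ := by simp only [tupleConst]; ring

omit [DecidableEq ι] in
theorem tupleConst_nonneg : 0 ≤ tupleConst F ι :=
  mul_nonneg sieveConst_nonneg
    (pow_nonneg (inv_nonneg.2 (sub_nonneg.2 inv_sqrtCard_lt_one.le)) _)

theorem abs_tupleFreq_sub_le {N : F[X]} (hN : N.Monic) {m : ℕ} {d e : ι → ℕ}
    (hd : ∀ α, m ≤ d α) (he : ∀ α, m ≤ e α) (A B : ι → F[X]) :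
    |tupleFreq N d A - tupleFreq N e B| ≤
      Fintype.card ι * (tupleConst F ι * 2) * (sqrtCard F)⁻¹ ^ m := by
  suffices h : ∀ S : Finset ι, |tupleFreq N d A - tupleFreq N (S.piecewise e d)
      (S.piecewise B A)| ≤ #S * (tupleConst F ι * 2) * (sqrtCard F)⁻¹ ^ m by
    simpa using h Finset.univ
  have hpow {k : ℕ} (hk : m ≤ k) : (sqrtCard F)⁻¹ ^ k ≤ (sqrtCard F)⁻¹ ^ m :=
    pow_le_pow_of_le_one inv_sqrtCard_pos.le inv_sqrtCard_lt_one.le hk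
  intro S
  induction S using Finset.induction_on with
  | empty => simp
  | insert α S hα ih =>
    have hstep := abs_tupleFreq_sub_update_le hN (S.piecewise e d) (S.piecewise B A) α (e α) (B α)
    rw [Finset.piecewise_eq_of_notMem _ _ _ hα] at hstep
    have hsum := mul_le_mul_of_nonneg_left (add_le_add (hpow (hd α)) (hpow (he α)))
      (tupleConst_nonneg (F := F) (ι := ι))
    rw [Finset.piecewise_insert, Finset.piecewise_insert, Finset.card_insert_of_notMem hα]
    push_cast
    linarith [abs_sub_le (tupleFreq N d A) (tupleFreq N (S.piecewise e d) (S.piecewise B A))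
      (tupleFreq N (Function.update (S.piecewise e d) α (e α))
        (Function.update (S.piecewise B A) α (B α)))]

theorem exists_abs_tupleFreq_sub_le (ι : Type*) [Fintype ι] [DecidableEq ι] {N : F[X]}
    (hN : N.Monic) : ∃ L K : ℝ, ∀ (m : ℕ) (d : ι → ℕ) (A : ι → F[X]), (∀ α, m ≤ d α) →
      |tupleFreq N d A - L| ≤ K * (sqrtCard F)⁻¹ ^ m := by
  set C : ℝ := Fintype.card ι * (tupleConst F ι * 2)
  obtain ⟨L, hL⟩ := exists_forall_abs_sub_le_of_abs_succ_sub_le (C := C)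
    (ρ := fun m (A : ι → F[X]) => tupleFreq N (fun _ => m) A) (inv_sqrtCard_lt_one (F := F))
    fun m A B => abs_tupleFreq_sub_le hN (fun _ => m.le_succ) (fun _ => le_rfl) A B
  refine ⟨L, C + C / (1 - (sqrtCard F)⁻¹), fun m d A hd => ?_⟩
  calc |tupleFreq N d A - L|
      ≤ C * (sqrtCard F)⁻¹ ^ m + C * (sqrtCard F)⁻¹ ^ m / (1 - (sqrtCard F)⁻¹) :=
        (abs_sub_le _ _ _).trans
          (add_le_add (abs_tupleFreq_sub_le hN hd (fun _ => le_rfl) A A) (hL m A))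
    _ = _ := by ring

end Tuples

section Positivity

theorem exists_eq_mul_mulSingle_of_prime_dvd_prod {ι M : Type*} [Fintype ι] [DecidableEq ι]
    [CommMonoidWithZero M] {p : M} (hp : Prime p) {f : ι → M} (h : p ∣ ∏ α, f α) :
    ∃ (α : ι) (f' : ι → M), f = f' * Pi.mulSingle α p := by
  obtain ⟨α, -, c, hc⟩ := hp.exists_mem_finset_dvd h
  refine ⟨α, Function.update f α c, funext fun β => ?_⟩
  rcases eq_or_ne β α with rfl | hβ
  · simp [hc, mul_comm]
  · simp [hβ]

theorem exists_monic_irreducible_sq_dvd {K : Type*} [Field K] {f : K[X]} (hf : f ≠ 0)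
    (h : ¬Squarefree f) : ∃ P : K[X], P.Monic ∧ Irreducible P ∧ P * P ∣ f := by
  classical
  rw [squarefree_iff_irreducible_sq_not_dvd_of_ne_zero hf] at h
  push Not at h
  obtain ⟨P, hP, hPf⟩ := h
  have hassoc := normalize_associated P
  exact ⟨normalize P, monic_normalize hP.ne_zero, hassoc.symm.irreducible hP,
    (hassoc.mul_mul hassoc).dvd.trans hPf⟩

theorem monic_mulSingle {R κ : Type*} [CommSemiring R] [DecidableEq κ] {P : R[X]} (hP : P.Monic)
    (a b : κ) : (Pi.mulSingle (M := fun _ => R[X]) a P b).Monic := by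
  rw [Pi.mulSingle_apply]
  split_ifs
  exacts [hP, monic_one]

/-- The contributions of `m` to the entries of a tuple when `m (α, β)` is a common factor of the
entries at `α` and `β` (and a square factor if `α = β`). -/
def pairProd {ι M : Type*} [Fintype ι] [CommMonoid M] (m : ι × ι → M) (α : ι) : M :=
  ∏ β, m (α, β) * m (β, α)

theorem pairProd_mul_mulSingle {ι M : Type*} [Fintype ι] [DecidableEq ι] [CommMonoid M]
    (m : ι × ι → M) (α β : ι) (p : M) :
    pairProd (m * Pi.mulSingle (α, β) p) =
      pairProd m * Pi.mulSingle α p * Pi.mulSingle β p := by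
  funext γ
  have hα : ∏ δ, Pi.mulSingle (M := fun _ => M) (α, β) p (γ, δ) =
      Pi.mulSingle (M := fun _ => M) α p γ := by
    simp [Pi.mulSingle_apply, ite_and, Finset.prod_ite_irrel]
  have hβ : ∏ δ, Pi.mulSingle (M := fun _ => M) (α, β) p (δ, γ) =
      Pi.mulSingle (M := fun _ => M) β p γ := by
    simp [Pi.mulSingle_apply, and_comm (b := γ = β), ite_and, Finset.prod_ite_irrel]
  simp only [pairProd, Pi.mul_apply, ← hα, ← hβ, Finset.prod_mul_distrib]
  ac_rfl

theorem exists_squarefree_prod_mul_pairProd {K ι : Type*} [Field K] [Fintype ι] {f : ι → K[X]}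
    (hf : ∀ α, (f α).Monic) :
    ∃ (g : ι → K[X]) (m : ι × ι → K[X]), (∀ α, (g α).Monic) ∧ Squarefree (∏ α, g α) ∧
      (∀ z, (m z).Monic) ∧ f = g * pairProd m := by
  classical
  induction hk : (∏ α, f α).natDegree using Nat.strong_induction_on generalizing f with
  | _ k ih =>
    by_cases hsq : Squarefree (∏ α, f α)
    · exact ⟨f, 1, hf, hsq, fun _ => monic_one, by ext1; simp [pairProd]⟩
    obtain ⟨P, hP, hPi, hPf⟩ := exists_monic_irreducible_sq_dvd
      (monic_prod_of_monic _ _ fun α _ => hf α).ne_zero hsq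
    obtain ⟨β, f', rfl⟩ :=
      exists_eq_mul_mulSingle_of_prime_dvd_prod hPi.prime ((dvd_mul_right P P).trans hPf)
    simp only [Pi.mul_apply, Finset.prod_mul_distrib, Finset.prod_pi_mulSingle', Finset.mem_univ,
      if_true, mul_dvd_mul_iff_right hP.ne_zero] at hPf hk
    obtain ⟨α, f, rfl⟩ := exists_eq_mul_mulSingle_of_prime_dvd_prod hPi.prime hPf
    have hf' : ∀ γ, (f γ).Monic := fun γ =>
      (monic_mulSingle hP α γ).of_mul_monic_right
        ((monic_mulSingle hP β γ).of_mul_monic_right (hf γ))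
    have hdeg : (∏ γ, f γ).natDegree < k := by
      have := hPi.natDegree_pos
      have hprod := monic_prod_of_monic Finset.univ _ fun γ _ => hf' γ
      simp only [Pi.mul_apply, Finset.prod_mul_distrib, Finset.prod_pi_mulSingle',
        Finset.mem_univ, if_true, (hprod.mul hP).natDegree_mul hP, hprod.natDegree_mul hP] at hk
      omega
    obtain ⟨g, m, hg, hgsq, hm, rfl⟩ := ih _ hdeg hf' rfl
    refine ⟨g, m * Pi.mulSingle (α, β) P, hg, hgsq, fun z => (hm z).mul (monic_mulSingle hP _ z),
      ?_⟩
    rw [pairProd_mul_mulSingle]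
    ac_rfl

variable {F : Type*} [Field F] [Fintype F] {ι : Type*} [Fintype ι] [DecidableEq ι]

open scoped Classical in
/-- The tuples of squarefree and pairwise coprime monic polynomials of degrees `d`. -/
def squarefreeTuples (F : Type*) [Field F] [Fintype F] (d : ι → ℕ) : Finset (ι → F[X]) :=
  {f ∈ tuples F d | Squarefree (∏ α, f α)}

theorem mem_squarefreeTuples {d : ι → ℕ} {f : ι → F[X]} :
    f ∈ squarefreeTuples F d ↔
      (∀ α, (f α).Monic ∧ (f α).natDegree = d α) ∧ Squarefree (∏ α, f α) := by
  simp [squarefreeTuples]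

/-- The additive analogue of `pairProd`: the degrees of `pairProd m` if `m` has degrees `e`. -/
def pairSum (e : ι × ι → ℕ) (α : ι) : ℕ := ∑ β, (e (α, β) + e (β, α))

omit [DecidableEq ι] in
theorem sum_pairSum (e : ι × ι → ℕ) : ∑ α, pairSum e α = 2 * ∑ z, e z := by
  simp only [pairSum, Finset.sum_add_distrib, Fintype.sum_prod_type]
  rw [Finset.sum_comm (f := fun α β => e (β, α)), two_mul]

omit [DecidableEq ι] in
theorem pairSum_le (e : ι × ι → ℕ) (α : ι) : pairSum e α ≤ 2 * ∑ z, e z :=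
  sum_pairSum e ▸ Finset.single_le_sum (fun _ _ => Nat.zero_le _) (Finset.mem_univ α)

theorem card_tuples_le_sum_squarefreeTuples (d : ι → ℕ) :
    #(tuples F d) ≤ ∑ e ∈ Fintype.piFinset fun z : ι × ι => Finset.range (d z.1 + 1) with
      ∀ α, pairSum e α ≤ d α,
      #(squarefreeTuples F fun α => d α - pairSum e α) * #(tuples F e) := by
  classical
  simp only [← Finset.card_product]
  refine (Finset.card_le_card fun f hf => ?_).trans <| Finset.card_biUnion_le.trans <|
    Finset.sum_le_sum fun e _ => Finset.card_image_le
      (f := fun gm : (ι → F[X]) × (ι × ι → F[X]) => gm.1 * pairProd gm.2)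
  rw [mem_tuples] at hf
  obtain ⟨g, m, hg, hsq, hm, rfl⟩ := exists_squarefree_prod_mul_pairProd fun α => (hf α).1
  have hdeg (α : ι) : (g α).natDegree + pairSum (fun z => (m z).natDegree) α = d α := by
    have hpair (β : ι) : (m (α, β) * m (β, α)).Monic := (hm _).mul (hm _)
    rw [← (hf α).2, Pi.mul_apply, pairProd,
      (hg α).natDegree_mul (monic_prod_of_monic _ _ fun β _ => hpair β),
      natDegree_prod_of_monic _ _ fun β _ => hpair β, pairSum]
    simp only [(hm _).natDegree_mul (hm _)]
  refine Finset.mem_biUnion.2 ⟨fun z => (m z).natDegree, ?_,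
    Finset.mem_image.2 ⟨(g, m), ?_, rfl⟩⟩
  · simp only [Finset.mem_filter, Fintype.mem_piFinset, Finset.mem_range, Prod.forall]
    refine ⟨fun α β => ?_, fun α => by have := hdeg α; omega⟩
    have hle : (m (α, β)).natDegree ≤ pairSum (fun z => (m z).natDegree) α :=
      (Nat.le_add_right _ _).trans <| Finset.single_le_sum
        (f := fun β => (m (α, β)).natDegree + (m (β, α)).natDegree)
        (fun _ _ => Nat.zero_le _) (Finset.mem_univ β)
    have := hdeg α
    omega
  · simp only [Finset.mem_product, mem_squarefreeTuples, mem_tuples]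
    exact ⟨⟨fun α => ⟨hg α, by have := hdeg α; omega⟩, hsq⟩, fun z => ⟨hm z, trivial⟩⟩

theorem card_squarefreeTuples_mul_card_tuples_le {K : ℝ}
    (h : ∀ (m : ℕ) (d : ι → ℕ), (∀ α, m ≤ d α) → (#(squarefreeTuples F d) : ℝ) ≤
      K * (sqrtCard F)⁻¹ ^ m * (Fintype.card F : ℝ) ^ ∑ α, d α)
    {M : ℕ} {e : ι × ι → ℕ} (he : ∀ α, pairSum e α ≤ M) :
    (#(squarefreeTuples F fun α => M - pairSum e α) * #(tuples F e) : ℝ) ≤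
      |K| * (sqrtCard F)⁻¹ ^ M * (Fintype.card F : ℝ) ^ (Fintype.card ι * M) := by
  set E : ℕ := ∑ z, e z
  have hsum : ∑ α, (M - pairSum e α) + 2 * E = Fintype.card ι * M := by
    rw [← sum_pairSum e, ← Finset.sum_add_distrib]
    simp [Nat.sub_add_cancel (he _)]
  have hq : (Fintype.card F : ℝ) ^ (2 * E) * (sqrtCard F)⁻¹ ^ (2 * E) = Fintype.card F ^ E := by
    have hq₀ : (Fintype.card F : ℝ) ≠ 0 := Nat.cast_ne_zero.2 Fintype.card_ne_zero
    rw [pow_mul, pow_mul, inv_pow, sqrtCard_sq, ← mul_pow, sq, mul_inv_cancel_right₀ hq₀]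
  have hs : (sqrtCard F)⁻¹ ^ (M - 2 * E) * (sqrtCard F)⁻¹ ^ (2 * E) ≤ (sqrtCard F)⁻¹ ^ M := by
    rw [← pow_add]
    exact pow_le_pow_of_le_one inv_sqrtCard_pos.le inv_sqrtCard_lt_one.le (by omega)
  have hG := h (M - 2 * E) (fun α => M - pairSum e α) fun α => by have := pairSum_le e α; omega
  rw [card_tuples, Nat.cast_pow, ← hq, ← hsum, pow_add]
  set D : ℝ := (Fintype.card F : ℝ) ^ ∑ α, (M - pairSum e α)
  calc (#(squarefreeTuples F fun α => M - pairSum e α) : ℝ) *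
        (Fintype.card F ^ (2 * E) * (sqrtCard F)⁻¹ ^ (2 * E))
      ≤ |K| * (sqrtCard F)⁻¹ ^ (M - 2 * E) * D *
        (Fintype.card F ^ (2 * E) * (sqrtCard F)⁻¹ ^ (2 * E)) := by
        have := inv_sqrtCard_pos (F := F)
        gcongr
        exact hG.trans (by gcongr; exact le_abs_self K)
    _ = |K| * ((sqrtCard F)⁻¹ ^ (M - 2 * E) * (sqrtCard F)⁻¹ ^ (2 * E)) *
        (D * Fintype.card F ^ (2 * E)) := by ring
    _ ≤ _ := by gcongr

theorem exists_lt_card_squarefreeTuples (F : Type*) [Field F] [Fintype F] (ι : Type*) [Fintype ι]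
    [DecidableEq ι] (K : ℝ) : ∃ (m : ℕ) (d : ι → ℕ), (∀ α, m ≤ d α) ∧
      K * (sqrtCard F)⁻¹ ^ m * (Fintype.card F : ℝ) ^ ∑ α, d α < #(squarefreeTuples F d) := by
  by_contra! h
  set k : ℕ := Fintype.card (ι × ι)
  have hone (M : ℕ) : 1 ≤ |K| * sqrtCard F *
      (((M + 1 : ℕ) : ℝ) ^ k * (sqrtCard F)⁻¹ ^ (M + 1)) := by
    have hq : (0 : ℝ) < Fintype.card F ^ (Fintype.card ι * M) :=
      pow_pos (Nat.cast_pos.2 Fintype.card_pos) _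
    have hsum : _ := Nat.cast_le (α := ℝ).2 <|
      card_tuples_le_sum_squarefreeTuples (F := F) fun _ : ι => M
    push_cast at hsum
    refine le_of_mul_le_mul_right ?_ hq
    calc 1 * (Fintype.card F : ℝ) ^ (Fintype.card ι * M) = #(tuples F fun _ : ι => M) := by
          simp [card_tuples]
      _ ≤ _ := hsum.trans <| Finset.sum_le_card_nsmul _ _ _ fun e he =>
          card_squarefreeTuples_mul_card_tuples_le h (Finset.mem_filter.1 he).2
      _ ≤ (M + 1 : ℕ) ^ k *
          (|K| * (sqrtCard F)⁻¹ ^ M * (Fintype.card F : ℝ) ^ (Fintype.card ι * M)) := by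
          rw [nsmul_eq_mul]
          have := inv_sqrtCard_pos (F := F)
          gcongr
          exact_mod_cast (Finset.card_filter_le _ _).trans (by simp [k])
      _ = _ := by
          rw [pow_succ (sqrtCard F)⁻¹]
          field_simp [(sqrtCard_pos (F := F)).ne']
  have hlim := ((tendsto_pow_const_mul_const_pow_of_abs_lt_one k
    ((abs_of_pos inv_sqrtCard_pos).trans_lt (inv_sqrtCard_lt_one (F := F)))).comp
      (Filter.tendsto_add_atTop_nat 1)).const_mul (|K| * sqrtCard F)
  rw [mul_zero] at hlim
  exact absurd (ge_of_tendsto' hlim hone) zero_lt_one.not_ge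

theorem SquarefreeAway.of_squarefree {K : Type*} [Field K] {f : K[X]} (hf : Squarefree f)
    (N : K[X]) : SquarefreeAway N f :=
  fun P _ hP _ hPf => hP.not_isUnit (hf P (sq P ▸ hPf))

theorem card_squarefreeTuples_le_sum_tupleCount {N : F[X]} (hN : N.Monic) (d : ι → ℕ) :
    #(squarefreeTuples F d) ≤
      ∑ A ∈ tuples F fun _ : ι => N.natDegree, tupleCount N d A := by
  classical
  refine (Finset.card_le_card fun f hf => ?_).trans Finset.card_biUnion_le
  rw [mem_squarefreeTuples] at hf
  refine Finset.mem_biUnion.2 ⟨fun α => N + f α %ₘ N, mem_tuples.2 fun α => ?_,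
    Finset.mem_filter.2 ⟨mem_tuples.2 hf.1, .of_squarefree hf.2 N, fun α => ?_⟩⟩
  · have hlt := degree_modByMonic_lt (f α) hN
    exact ⟨hN.add_of_left hlt, natDegree_add_eq_left_of_degree_lt hlt⟩
  · dsimp only
    rw [modByMonic_eq_sub_mul_div]
    exact ⟨f α /ₘ N - 1, by ring⟩

theorem exists_pos_abs_tupleFreq_sub_le (ι : Type*) [Fintype ι] [DecidableEq ι] {N : F[X]}
    (hN : N.Monic) : ∃ L > 0, ∃ K : ℝ, ∀ (m : ℕ) (d : ι → ℕ) (A : ι → F[X]), (∀ α, m ≤ d α) →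
      |tupleFreq N d A - L| ≤ K * (sqrtCard F)⁻¹ ^ m := by
  obtain ⟨L, K, h⟩ := exists_abs_tupleFreq_sub_le ι hN
  refine ⟨L, lt_of_not_ge fun hL => ?_, K, h⟩
  obtain ⟨m, d, hd, hlt⟩ := exists_lt_card_squarefreeTuples F ι
    (#(tuples F fun _ : ι => N.natDegree) * K)
  refine hlt.not_ge ?_
  have hq : (0 : ℝ) < Fintype.card F ^ ∑ α, d α := pow_pos (Nat.cast_pos.2 Fintype.card_pos) _
  have hcount (A : ι → F[X]) :
      (tupleCount N d A : ℝ) ≤ K * (sqrtCard F)⁻¹ ^ m * Fintype.card F ^ ∑ α, d α :=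
    (div_le_iff₀ hq).1 (by linarith [(abs_le.1 (h m d A hd)).2, tupleFreq.eq_1 N d A])
  calc (#(squarefreeTuples F d) : ℝ)
      ≤ ∑ A ∈ tuples F fun _ : ι => N.natDegree, (tupleCount N d A : ℝ) :=
        mod_cast card_squarefreeTuples_le_sum_tupleCount hN d
    _ ≤ _ := Finset.sum_le_card_nsmul _ _ _ fun A _ => hcount A
    _ = _ := by rw [nsmul_eq_mul]; ring

end Positivity

section Jets

variable {K : Type*} [Field K]

/-- The values of a polynomial and of its derivative at all points: the first order data which
decide whether `f` is squarefree at the rational points. -/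
def jet (K : Type*) [Field K] : K[X] →ₗ[K] (K → K × K) where
  toFun p x := (p.eval x, p.derivative.eval x)
  map_add' p p' := by ext <;> simp
  map_smul' c p := by ext <;> simp

@[simp] theorem jet_apply (p : K[X]) (x : K) : jet K p x = (p.eval x, p.derivative.eval x) := rfl

/-- The modulus `∏ x, (X - x) ^ 2`: a residue class modulo it is the same as a value of `jet F`. -/
def jetModulus (F : Type*) [Field F] [Fintype F] : F[X] := ∏ x, (X - C x) ^ 2

theorem X_sub_C_sq_dvd_iff {x : K} {p : K[X]} : (X - C x) ^ 2 ∣ p ↔ jet K p x = 0 := by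
  rcases eq_or_ne p 0 with rfl | hp
  · simp
  · rw [← le_rootMultiplicity_iff hp, jet_apply, Prod.mk_eq_zero]
    exact one_lt_rootMultiplicity_iff_isRoot hp

variable {F : Type*} [Field F] [Fintype F]

theorem monic_jetModulus : (jetModulus F).Monic :=
  monic_prod_of_monic _ _ fun x _ => (monic_X_sub_C x).pow 2

theorem pairwise_isCoprime_X_sub_C_sq :
    Pairwise (Function.onFun IsCoprime fun x : K => (X - C x) ^ 2) :=
  fun _ _ hxy => IsCoprime.pow (isCoprime_X_sub_C_of_isUnit_sub (sub_ne_zero.2 hxy).isUnit)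

theorem jetModulus_dvd_sub_iff {p p' : F[X]} : jetModulus F ∣ p - p' ↔ jet F p = jet F p' := by
  rw [← sub_eq_zero (a := jet F p), ← map_sub, funext_iff]
  simp only [Pi.zero_apply, ← X_sub_C_sq_dvd_iff]
  exact ⟨fun h x => (Finset.dvd_prod_of_mem (fun x => (X - C x) ^ 2) (Finset.mem_univ x)).trans h,
    Fintype.prod_dvd_of_coprime pairwise_isCoprime_X_sub_C_sq⟩

theorem jet_surjective [Finite K] : Function.Surjective (jet K) := by
  intro a
  obtain ⟨p, hp⟩ := Ideal.exists_forall_sub_mem_ideal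
    (I := fun x : K => Ideal.span {(X - C x) ^ 2})
    (fun x y hxy => (Ideal.isCoprime_span_singleton_iff _ _).2 (pairwise_isCoprime_X_sub_C_sq hxy))
    fun x => C (a x).1 + C (a x).2 * (X - C x)
  refine ⟨p, funext fun x => ?_⟩
  have hpx := hp x
  rw [Ideal.mem_span_singleton, X_sub_C_sq_dvd_iff, map_sub, Pi.sub_apply, sub_eq_zero] at hpx
  simp [hpx]

theorem squarefree_iff_squarefreeAway {f : F[X]} (hf : f ≠ 0) :
    Squarefree f ↔ SquarefreeAway (jetModulus F) f ∧ ∀ x, ¬(X - C x) ^ 2 ∣ f := by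
  refine ⟨fun h => ⟨.of_squarefree h _, fun x hx => ?_⟩, fun ⟨haway, hlin⟩ => ?_⟩
  · exact (irreducible_X_sub_C x).not_isUnit (h _ (sq (X - C x) ▸ hx))
  · by_contra h
    obtain ⟨P, hm, hP, hPf⟩ := exists_monic_irreducible_sq_dvd hf h
    rw [← sq] at hPf
    refine haway P hm hP (fun hPN => ?_) hPf
    obtain ⟨x, -, hx⟩ := (hP.prime.dvd_finsetProd_iff _).1 hPN
    have hPx : P = X - C x := eq_of_monic_of_associated hm (monic_X_sub_C x)
      (hP.associated_of_dvd (irreducible_X_sub_C x) (hP.prime.dvd_of_dvd_pow hx))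
    exact hlin x (hPx ▸ hPf)

variable {ι : Type*} [Fintype ι]

theorem squarefree_prod_iff {f : ι → K[X]} :
    Squarefree (∏ α, f α) ↔
      (∀ α, Squarefree (f α)) ∧ ∀ α β, α ≠ β → IsCoprime (f α) (f β) := by
  classical
  refine ⟨fun h => ⟨fun α => h.squarefree_of_dvd (Finset.dvd_prod_of_mem f (Finset.mem_univ α)),
    fun α β hαβ => ?_⟩, fun ⟨hsq, hco⟩ => ?_⟩
  · have hdvd : f α * f β ∣ ∏ α, f α := by
      rw [← Finset.prod_pair hαβ]
      exact Finset.prod_dvd_prod_of_subset _ _ _ (Finset.subset_univ _)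
    exact (IsRelPrime.of_squarefree_mul (h.squarefree_of_dvd hdvd)).isCoprime
  · exact Finset.squarefree_prod_of_pairwise_isCoprime (fun α _ β _ h => (hco α β h).isRelPrime)
      fun α _ => hsq α

open scoped Classical in
/-- The possible values of the `jet` of `f_α` at a point `x` of ramification type `τ`: at such a
point `f_α` has a simple zero if `τ = some α`, and no zero otherwise. -/
def typeSet (F : Type*) [Field F] [Fintype F] (τ : Option ι) (α : ι) : Finset (F × F) :=
  if τ = some α then {0} ×ˢ ({0}ᶜ : Finset F) else ({0}ᶜ : Finset F) ×ˢ Finset.univ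

/-- The possible values of the `jet`s of `(f_α)` at a point of ramification type `τ`. -/
def typeData (F : Type*) [Field F] [Fintype F] {ι : Type*} [Fintype ι] [DecidableEq ι]
    (τ : Option ι) : Finset (ι → F × F) :=
  Fintype.piFinset (typeSet F τ)

theorem mem_typeData [DecidableEq ι] {τ : Option ι} {b : ι → F × F} :
    b ∈ typeData F τ ↔
      ∀ α, ((b α).1 = 0 ↔ τ = some α) ∧ ((b α).1 = 0 → (b α).2 ≠ 0) := by
  classical
  rw [typeData, Fintype.mem_piFinset]
  refine forall_congr' fun α => ?_
  rw [typeSet]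
  split_ifs with h <;> rw [Finset.mem_product]
  · simp +contextual [h, -Finset.singleton_product]
  · simpa [h] using fun h h' => absurd h' h

theorem not_X_sub_C_sq_dvd_prod_iff [DecidableEq ι] {f : ι → F[X]} {x : F} :
    ¬(X - C x) ^ 2 ∣ ∏ α, f α ↔ ∃ τ, (fun α => jet F (f α) x) ∈ typeData F τ := by
  have hp : Prime (X - C x) := prime_X_sub_C x
  have hroot (α : ι) : X - C x ∣ f α ↔ (jet F (f α) x).1 = 0 := dvd_iff_isRoot
  have hjet (α : ι) : (X - C x) ^ 2 ∣ f α ↔ (jet F (f α) x).1 = 0 ∧ (jet F (f α) x).2 = 0 :=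
    X_sub_C_sq_dvd_iff.trans Prod.ext_iff
  simp only [mem_typeData, ← hroot]
  constructor
  · intro h
    by_cases hex : ∃ α, X - C x ∣ f α
    · obtain ⟨α, hα⟩ := hex
      refine ⟨some α, fun β => ⟨⟨fun hβ => ?_, ?_⟩, fun hβ hβ' => h ?_⟩⟩
      · by_contra hαβ
        refine h ((sq (X - C x) ▸ mul_dvd_mul hα hβ).trans ?_)
        rw [← Finset.prod_pair fun heq => hαβ (congrArg some heq)]
        exact Finset.prod_dvd_prod_of_subset _ _ _ (Finset.subset_univ _)
      · rintro ⟨⟩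
        exact hα
      · exact ((hjet β).2 ⟨(hroot β).1 hβ, hβ'⟩).trans
          (Finset.dvd_prod_of_mem f (Finset.mem_univ β))
    · push Not at hex
      exact ⟨none, fun β => by simp [hex β]⟩
  · rintro ⟨τ, hτ⟩ hdvd
    obtain ⟨α, -, hα⟩ := (hp.dvd_finsetProd_iff _).1 ((dvd_pow_self _ two_ne_zero).trans hdvd)
    have hrest : ¬X - C x ∣ ∏ β ∈ Finset.univ.erase α, f β := by
      rw [hp.dvd_finsetProd_iff]
      rintro ⟨β, hβ, hβ'⟩
      exact Finset.ne_of_mem_erase hβ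
        (Option.some_injective _ (((hτ β).1.1 hβ').symm.trans ((hτ α).1.1 hα)))
    rw [← Finset.mul_prod_erase _ _ (Finset.mem_univ α)] at hdvd
    exact (hτ α).2 hα ((hjet α).1 (hp.pow_dvd_of_dvd_mul_right 2 hrest hdvd)).2

theorem squarefree_prod_iff_jet_mem_typeData [DecidableEq ι] {f : ι → F[X]} (hf : ∀ α, f α ≠ 0) :
    Squarefree (∏ α, f α) ↔ SquarefreeAway (jetModulus F) (∏ α, f α) ∧
      ∀ x, ∃ τ, (fun α => jet F (f α) x) ∈ typeData F τ := by
  rw [squarefree_iff_squarefreeAway (Finset.prod_ne_zero_iff.2 fun α _ => hf α)]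
  simp only [not_X_sub_C_sq_dvd_prod_iff]

end Jets

section DualGroup

variable {n : ℕ}

theorem mem_divVectors {r : Fin (n + 1) → ℕ} (hr : ∀ j, r j ≠ 0) {s : Fin (n + 1) → ℕ} :
    s ∈ divVectors r ↔ ∀ j, s j ∣ r j := by
  simp [divVectors, hr]

theorem mem_Omega {s ω : Fin (n + 1) → ℕ} :
    ω ∈ Omega s ↔ ∀ j, (1 ≤ ω j ∧ ω j ≤ s j) ∧ (ω j).Coprime (s j) := by
  simp [Omega]

theorem dvd_ell (s : Fin (n + 1) → ℕ) (j : Fin (n + 1)) : s j ∣ ell s :=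
  Finset.dvd_lcm (Finset.mem_univ j)

theorem dvd_last {r : Fin (n + 1) → ℕ} (hr : ∀ j : Fin n, r j.castSucc ∣ r j.succ)
    (j : Fin (n + 1)) : r j ∣ r (Fin.last n) := by
  induction j using Fin.reverseInduction with
  | last => exact dvd_rfl
  | cast j ih => exact (hr j).trans ih

theorem ell_dvd {r s : Fin (n + 1) → ℕ} (hr : ∀ j : Fin n, r j.castSucc ∣ r j.succ)
    (hs : ∀ j, s j ∣ r j) : ell s ∣ r (Fin.last n) :=
  Finset.lcm_dvd fun j _ => (hs j).trans (dvd_last hr j)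

theorem card_Omega (s : Fin (n + 1) → ℕ) : #(Omega s) = ∏ j, (s j).totient := by
  rw [Omega, Fintype.card_piFinset]
  refine Finset.prod_congr rfl fun j _ => ?_
  rw [← Nat.filter_coprime_Ico_eq_totient (s j) 1, add_comm]
  simp only [Nat.coprime_comm, Finset.Ico_add_one_right_eq_Icc]

theorem card_sigma_Omega (r : Fin (n + 1) → ℕ) : #((divVectors r).sigma Omega) = groupOrder r := by
  simp only [Finset.card_sigma, card_Omega, divVectors, ← Finset.prod_univ_sum, Nat.sum_totient,
    groupOrder]

variable {F : Type*} [Field F]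

/-- The tuples of characters with `ψ_j ^ r_j = 1`: the dual of `G = ∏ j, ℤ/r_j` as soon as `F`
contains the roots of unity of order `r_j`. -/
def dualGroup (F : Type*) [Field F] (r : Fin (n + 1) → ℕ) :
    Subgroup (Fin (n + 1) → MulChar F ℂ) :=
  Subgroup.pi Set.univ fun j => (powMonoidHom (r j)).ker

theorem mem_dualGroup {r : Fin (n + 1) → ℕ} {ψ : Fin (n + 1) → MulChar F ℂ} :
    ψ ∈ dualGroup F r ↔ ∀ j, ψ j ^ r j = 1 := by
  simp [dualGroup, Subgroup.mem_pi]

/-- The pairing `ψ ↦ ∏ j, ψ_j ^ t_j` of tuples of characters with an integer vector `t`. -/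
def pairing (F : Type*) [Field F] (t : Fin (n + 1) → ℕ) :
    (Fin (n + 1) → MulChar F ℂ) →* MulChar F ℂ where
  toFun ψ := ∏ j, ψ j ^ t j
  map_one' := by simp
  map_mul' ψ ψ' := by simp [mul_pow, Finset.prod_mul_distrib]

theorem pairing_apply (t : Fin (n + 1) → ℕ) (ψ : Fin (n + 1) → MulChar F ℂ) :
    pairing F t ψ = ∏ j, ψ j ^ t j := rfl

/-- The elements of the dual group which are trivial on `t`. -/
def annihilator (F : Type*) [Field F] (r t : Fin (n + 1) → ℕ) : Subgroup (dualGroup F r) :=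
  ((pairing F t).domRestrict (dualGroup F r)).ker

theorem mem_annihilator {r t : Fin (n + 1) → ℕ} {ψ : dualGroup F r} :
    ψ ∈ annihilator F r t ↔ pairing F t ψ = 1 := Iff.rfl

/-- The element of `G = ∏ j, ℤ/r_j` given by an integer vector. -/
def toGroup (r t : Fin (n + 1) → ℕ) (j : Fin (n + 1)) : ZMod (r j) := t j

theorem toGroup_nsmul (r t : Fin (n + 1) → ℕ) (k : ℕ) : toGroup r (k • t) = k • toGroup r t := by
  funext j
  simp [toGroup]

theorem toGroup_eq_zero_iff {r t : Fin (n + 1) → ℕ} : toGroup r t = 0 ↔ ∀ j, r j ∣ t j := by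
  simp [funext_iff, toGroup, ZMod.natCast_eq_zero_iff]

theorem pairing_mulSingle (t : Fin (n + 1) → ℕ) (j : Fin (n + 1)) (η : MulChar F ℂ) :
    pairing F t (Pi.mulSingle j η) = η ^ t j := by
  rw [pairing_apply, Finset.prod_eq_single j, Pi.mulSingle_eq_same]
  · exact fun i _ hi => by rw [Pi.mulSingle_eq_of_ne hi, one_pow]
  · simp

theorem pairing_nsmul (k : ℕ) (t : Fin (n + 1) → ℕ) (ψ : Fin (n + 1) → MulChar F ℂ) :
    pairing F (k • t) ψ = pairing F t ψ ^ k := by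
  simp only [pairing_apply, Pi.smul_apply, smul_eq_mul, ← Finset.prod_pow, ← pow_mul, mul_comm]

/-- The tuple of characters of `F` which belongs to the summand `(s, ω)` of the character sum. -/
def charTuple (χ : ℕ → MulChar F ℂ) (s ω : Fin (n + 1) → ℕ) (j : Fin (n + 1)) : MulChar F ℂ :=
  χ (ell s) ^ (ell s / s j * ω j)

section

variable {χ : ℕ → MulChar F ℂ} {s ω : Fin (n + 1) → ℕ}

theorem orderOf_pow_ell_div (hs : ell s ≠ 0) (hχ : orderOf (χ (ell s)) = ell s)
    (j : Fin (n + 1)) : orderOf (χ (ell s) ^ (ell s / s j)) = s j := by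
  have h := orderOf_pow_orderOf_div (x := χ (ell s)) (hχ.trans_ne hs) (n := s j)
  rw [hχ] at h
  exact h (dvd_ell s j)

theorem orderOf_charTuple (hs : ell s ≠ 0) (hχ : orderOf (χ (ell s)) = ell s) (hω : ω ∈ Omega s)
    (j : Fin (n + 1)) : orderOf (charTuple χ s ω j) = s j := by
  have hord := orderOf_pow_ell_div hs hχ j
  rw [charTuple, pow_mul, Nat.Coprime.orderOf_pow (by rw [hord]; exact (mem_Omega.1 hω j).2.symm),
    hord]

theorem charTuple_injOn_Omega (hs : ell s ≠ 0) (hχ : orderOf (χ (ell s)) = ell s) :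
    Set.InjOn (charTuple χ s) (Omega s) := by
  intro ω hω ω' hω' heq
  rw [Finset.mem_coe, mem_Omega] at hω hω'
  funext j
  have hj := congrFun heq j
  simp only [charTuple, pow_mul] at hj
  rw [pow_eq_pow_iff_modEq, orderOf_pow_ell_div hs hχ] at hj
  obtain ⟨⟨hpos, hle⟩, -⟩ := hω j
  obtain ⟨⟨hpos', hle'⟩, -⟩ := hω' j
  rw [← Nat.sub_add_cancel hpos, ← Nat.sub_add_cancel hpos'] at hj ⊢
  rw [(Nat.ModEq.add_right_cancel' 1 hj).eq_of_lt_of_lt (by lia) (by lia)]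

end

variable [Fintype F] {r : Fin (n + 1) → ℕ}

instance : Fintype (dualGroup F r) := Fintype.ofFinite _

theorem isCyclic_mulChar (F : Type*) [Field F] [Finite F] : IsCyclic (MulChar F ℂ) := by
  obtain ⟨e⟩ := MulChar.mulEquiv_units F ℂ
  exact e.isCyclic.2 inferInstance

theorem card_mulChar (F : Type*) [Field F] [Fintype F] :
    Nat.card (MulChar F ℂ) = Fintype.card F - 1 := by
  classical
  rw [MulChar.card_eq_card_units_of_hasEnoughRootsOfUnity, Nat.card_eq_fintype_card,
    Fintype.card_units]

theorem exists_orderOf_mulChar_eq {k : ℕ} (hk : k ∣ Fintype.card F - 1) :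
    ∃ η : MulChar F ℂ, orderOf η = k := by
  have := isCyclic_mulChar F
  obtain ⟨g, hg⟩ := IsCyclic.exists_ofOrder_eq_natCard (α := MulChar F ℂ)
  rw [card_mulChar] at hg
  exact ⟨g ^ (orderOf g / k), orderOf_pow_orderOf_div (orderOf_pos g).ne' (hg ▸ hk)⟩

theorem card_dualGroup (hr : ∀ j, r j ∣ Fintype.card F - 1) :
    Nat.card (dualGroup F r) = groupOrder r := by
  have := isCyclic_mulChar F
  have e : dualGroup F r ≃ ∀ j, (powMonoidHom (r j) : MulChar F ℂ →* _).ker :=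
    (Equiv.subtypeEquivRight fun ψ => by simp [dualGroup, Subgroup.mem_pi]).trans
      (Equiv.subtypePiEquivPi (p := fun j η => η ∈ (powMonoidHom (r j) : MulChar F ℂ →* _).ker))
  rw [Nat.card_congr e, Nat.card_pi, groupOrder]
  refine Finset.prod_congr rfl fun j _ => ?_
  rw [IsCyclic.card_powMonoidHom_ker, card_mulChar, Nat.gcd_eq_right (hr j)]

theorem ne_zero_of_dvd_card_sub_one (hr : ∀ j, r j ∣ Fintype.card F - 1) (j : Fin (n + 1)) :
    r j ≠ 0 :=
  ne_zero_of_dvd_ne_zero (Nat.sub_ne_zero_of_lt Fintype.one_lt_card) (hr j)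

theorem sum_charTuple {M : Type*} [AddCommMonoid M] {χ : ℕ → MulChar F ℂ}
    (hr : ∀ j, r j ∣ Fintype.card F - 1) (hr_dvd : ∀ j : Fin n, r j.castSucc ∣ r j.succ)
    (hχ : ∀ m, m ∣ r (Fin.last n) → orderOf (χ m) = m) (Φ : (Fin (n + 1) → MulChar F ℂ) → M) :
    ∑ s ∈ divVectors r, ∑ ω ∈ Omega s, Φ (charTuple χ s ω) = ∑ ψ : dualGroup F r, Φ ψ := by
  classical
  have hr0 := ne_zero_of_dvd_card_sub_one hr
  have hell {s} (hs : s ∈ divVectors r) : ell s ≠ 0 ∧ orderOf (χ (ell s)) = ell s :=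
    have hdvd := ell_dvd hr_dvd ((mem_divVectors hr0).1 hs)
    ⟨ne_zero_of_dvd_ne_zero (hr0 _) hdvd, hχ _ hdvd⟩
  let E := (divVectors r).sigma Omega
  let T (x : Σ _ : Fin (n + 1) → ℕ, Fin (n + 1) → ℕ) := charTuple χ x.1 x.2
  have horder {x} (hx : x ∈ E) (j) : orderOf (charTuple χ x.1 x.2 j) = x.1 j :=
    have hx := Finset.mem_sigma.1 hx
    orderOf_charTuple (hell hx.1).1 (hell hx.1).2 hx.2 j
  have hinj : Set.InjOn T E := by
    rintro ⟨s, ω⟩ hx ⟨s', ω'⟩ hx' heq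
    obtain rfl : s = s' := funext fun j =>
      (horder hx j).symm.trans ((congrArg orderOf (congrFun heq j)).trans (horder hx' j))
    rw [Finset.mem_coe, Finset.mem_sigma] at hx hx'
    obtain rfl := charTuple_injOn_Omega (hell hx.1).1 (hell hx.1).2 hx.2 hx'.2 heq
    rfl
  have himage : ↑(E.image T) = (dualGroup F r : Set (Fin (n + 1) → MulChar F ℂ)) := by
    refine Set.eq_of_subset_of_ncard_le ?_ ?_
    · rintro _ hψ
      obtain ⟨x, hx, rfl⟩ := Finset.mem_image.1 hψ
      refine mem_dualGroup.2 fun j => orderOf_dvd_iff_pow_eq_one.1 ?_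
      rw [horder hx j]
      exact (mem_divVectors hr0).1 (Finset.mem_sigma.1 hx).1 j
    · rw [Set.ncard_coe_finset, Finset.card_image_of_injOn hinj, card_sigma_Omega]
      exact (card_dualGroup hr).le
  rw [Finset.sum_sigma', ← Finset.sum_image hinj (f := Φ)]
  exact Finset.sum_subtype _ (fun ψ => by rw [← Finset.mem_coe, himage, SetLike.mem_coe]) _

theorem forall_pairing_eq_one_iff (hr : ∀ j, r j ∣ Fintype.card F - 1) {t : Fin (n + 1) → ℕ} :
    (∀ ψ : dualGroup F r, pairing F t ψ = 1) ↔ toGroup r t = 0 := by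
  rw [toGroup_eq_zero_iff]
  constructor
  · intro h j
    obtain ⟨η, hη⟩ := exists_orderOf_mulChar_eq (hr j)
    have hmem : Pi.mulSingle j η ∈ dualGroup F r := mem_dualGroup.2 fun i => by
      rcases eq_or_ne i j with rfl | hi
      · rw [Pi.mulSingle_eq_same, ← hη, pow_orderOf_eq_one]
      · rw [Pi.mulSingle_eq_of_ne hi, one_pow]
    have hpair := h ⟨_, hmem⟩
    rw [pairing_mulSingle] at hpair
    exact hη ▸ orderOf_dvd_of_pow_eq_one hpair
  · intro h ψ
    rw [pairing_apply]
    refine Finset.prod_eq_one fun j _ => ?_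
    obtain ⟨k, hk⟩ := h j
    rw [hk, pow_mul, mem_dualGroup.1 ψ.2 j, one_pow]

theorem card_annihilator_mul_addOrderOf (hr : ∀ j, r j ∣ Fintype.card F - 1)
    (t : Fin (n + 1) → ℕ) :
    Nat.card (annihilator F r t) * addOrderOf (toGroup r t) = groupOrder r := by
  have := isCyclic_mulChar F
  let f := (pairing F t).domRestrict (dualGroup F r)
  have hrange : Nat.card f.range = addOrderOf (toGroup r t) := by
    refine Nat.dvd_right_iff_eq.1 fun k => ?_
    rw [← IsCyclic.exponent_eq_card, Monoid.exponent_dvd_iff_forall_pow_eq_one,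
      addOrderOf_dvd_iff_nsmul_eq_zero, ← toGroup_nsmul, ← forall_pairing_eq_one_iff hr]
    simp only [pairing_nsmul]
    exact ⟨fun h ψ => congrArg Subtype.val (h ⟨f ψ, ψ, rfl⟩),
      fun h ⟨_, ψ, hψ⟩ => Subtype.ext (hψ ▸ h ψ)⟩
  rw [← hrange, ← Subgroup.index_ker, ← card_dualGroup hr]
  exact Subgroup.card_mul_index _

end DualGroup

section LocalSums

variable {F : Type*} [Field F] {n : ℕ} {r : Fin (n + 1) → ℕ}

open scoped Classical in
/-- The character `η`, with the value `1` at `0` if it is trivial. -/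
def extChar (η : MulChar F ℂ) (x : F) : ℂ := if x = 0 then (if η = 1 then 1 else 0) else η x

theorem map_pow_mod_eq_extChar {η : MulChar F ℂ} {l : ℕ} (hη : orderOf η = l) (k : ℕ) (x : F) :
    η (x ^ (k % l)) = extChar (η ^ k) x := by
  have hpow : η ^ k = 1 ↔ k % l = 0 := by
    rw [← orderOf_dvd_iff_pow_eq_one, hη, Nat.dvd_iff_mod_eq_zero]
  rcases eq_or_ne x 0 with rfl | hx
  · rw [extChar, if_pos rfl]
    split_ifs with hk
    · rw [hpow.1 hk, pow_zero, map_one]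
    · rw [zero_pow (hk ∘ hpow.2), MulChar.map_zero]
  · lift x to Fˣ using hx.isUnit
    rw [extChar, if_neg x.ne_zero, map_pow, ← MulChar.pow_apply_coe, ← hη, pow_mod_orderOf]

theorem extChar_one (x : F) : extChar 1 x = 1 := by
  rcases eq_or_ne x 0 with rfl | hx
  · rw [extChar, if_pos rfl, if_pos rfl]
  · rw [extChar, if_neg hx, MulChar.one_apply hx.isUnit]

theorem sum_extChar_typeSet [Fintype F] {ι : Type*} {η : MulChar F ℂ} (hη : η ≠ 1)
    (τ : Option ι) (α : ι) : ∑ b ∈ typeSet F τ α, extChar η b.1 = 0 := by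
  classical
  have hext : extChar η = η := funext fun x => by
    rw [extChar, if_neg hη, ite_eq_right_iff]
    rintro rfl
    exact η.map_zero.symm
  rw [hext, typeSet]
  split_ifs with h
  · refine Finset.sum_eq_zero fun b hb => ?_
    rw [Finset.mem_singleton.1 (Finset.mem_product.1 hb).1, η.map_zero]
  · rw [Finset.sum_product_right]
    refine Finset.sum_eq_zero fun y _ => ?_
    rw [← MulChar.sum_eq_zero_of_ne_one hη, ← Finset.sum_compl_add_sum {(0 : F)},
      Finset.sum_singleton, η.map_zero, add_zero]

/-- The integer vector underlying an index. -/
def idxVec (α : Idx r) (j : Fin (n + 1)) : ℕ := α.1 j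

/-- The integer vector attached to a ramification type: that of the index `α` for `some α`, and `0`
for `none`, the unramified type. -/
def typeVec : Option (Idx r) → Fin (n + 1) → ℕ
  | none => 0
  | some α => idxVec α

theorem pairing_charTuple (χ : ℕ → MulChar F ℂ) (s ω t : Fin (n + 1) → ℕ) :
    pairing F t (charTuple χ s ω) = χ (ell s) ^ ∑ j, ell s / s j * ω j * t j := by
  simp only [pairing_apply, charTuple, ← pow_mul, Finset.prod_pow_eq_pow_sum]

theorem map_leadCoeff {χ : ℕ → MulChar F ℂ} {s : Fin (n + 1) → ℕ}
    (hs : orderOf (χ (ell s)) = ell s) (ω : Fin (n + 1) → ℕ) (c : Fin (n + 1) → Fˣ) :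
    χ (ell s) (leadCoeff s ω c) = ∏ j, charTuple χ s ω j (c j) := by
  rw [leadCoeff, map_prod]
  refine Finset.prod_congr rfl fun j _ => ?_
  rw [map_pow_mod_eq_extChar hs, extChar, if_neg (c j).ne_zero, charTuple]

theorem exists_pairing_ne_one (hr : ∀ j, r j ≠ 0) {ψ : dualGroup F r} (hψ : ψ ≠ 1) :
    ∃ α : Idx r, pairing F (idxVec α) ψ ≠ 1 := by
  obtain ⟨j, hj⟩ := Function.ne_iff.1 (Subtype.coe_injective.ne hψ)
  have hrj : 1 < r j := (Nat.two_le_iff _).2 ⟨hr j, fun h => hj <| by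
    rw [OneMemClass.coe_one, Pi.one_apply, ← mem_dualGroup.1 ψ.2 j, h, pow_one]⟩
  let α : Idx r := ⟨fun i => if h : i = j then ⟨1, h ▸ hrj⟩ else ⟨0, (hr i).bot_lt⟩, j, by simp⟩
  have hα : pairing F (idxVec α) ψ = ψ.1 j := by
    rw [pairing_apply, Fintype.prod_eq_single j fun i hi => by simp [idxVec, α, hi]]
    simp [idxVec, α]
  exact ⟨α, hα ▸ hj⟩

/-- Evaluation of multiplicative characters at a unit. -/
def evalHom (u : Fˣ) : MulChar F ℂ →* ℂ where
  toFun η := η u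
  map_one' := MulChar.one_apply_coe u
  map_mul' η η' := MulChar.mul_apply η η' u

/-- The character of the dual group which agrees with the summand of a local sum with constants `c`
and non-zero values `u`. -/
def dualHom (c : Fin (n + 1) → Fˣ) (u : Idx r → Fˣ) : (Fin (n + 1) → MulChar F ℂ) →* ℂ :=
  (∏ j, (evalHom (c j)).comp (Pi.evalMonoidHom _ j)) *
    ∏ α, (evalHom (u α)).comp (pairing F (idxVec α))

theorem dualHom_apply (c : Fin (n + 1) → Fˣ) (u : Idx r → Fˣ) (ψ : Fin (n + 1) → MulChar F ℂ) :
    dualHom c u ψ = (∏ j, ψ j (c j)) * ∏ α, pairing F (idxVec α) ψ (u α) := by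
  simp [dualHom, evalHom, MonoidHom.finsetProd_apply]

variable [Fintype F]

/-- The character sum at a finite point, as a function of the constants and the values there. -/
def localSum (c : Fin (n + 1) → Fˣ) (v : Idx r → F) : ℂ :=
  ∑ ψ : dualGroup F r, (∏ j, ψ.1 j (c j)) * ∏ α, extChar (pairing F (idxVec α) ψ) (v α)

open scoped Classical in
/-- The character sum at infinity, as a function of the constants and the degrees. -/
def inftySum (r : Fin (n + 1) → ℕ) (c : Fin (n + 1) → Fˣ) (t : Fin (n + 1) → ℕ) : ℂ :=
  ∑ ψ : dualGroup F r, if pairing F t ψ = 1 then ∏ j, ψ.1 j (c j) else 0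

section

variable {χ : ℕ → MulChar F ℂ}

theorem charSum_some (hr : ∀ j, r j ∣ Fintype.card F - 1)
    (hr_dvd : ∀ j : Fin n, r j.castSucc ∣ r j.succ)
    (hχ : ∀ m, m ∣ r (Fin.last n) → orderOf (χ m) = m) (p : Datum F r) (x : F) :
    charSum χ p (OnePoint.some x) = localSum p.1 fun α => (p.2 α).eval x := by
  refine Eq.trans ?_ (sum_charTuple hr hr_dvd hχ fun ψ =>
    (∏ j, ψ j (p.1 j)) * ∏ α, extChar (pairing F (idxVec α) ψ) ((p.2 α).eval x))
  refine Finset.sum_congr rfl fun s hs => Finset.sum_congr rfl fun ω _ => ?_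
  have hs := hχ _ (ell_dvd hr_dvd ((mem_divVectors (ne_zero_of_dvd_card_sub_one hr)).1 hs))
  change χ (ell s) ((Fpoly s ω p).eval x) = _
  rw [Fpoly, eval_mul, eval_C, eval_prod, map_mul, map_leadCoeff hs, map_prod]
  simp only [eval_pow, map_pow_mod_eq_extChar hs, pairing_charTuple, idxVec]

theorem charSum_none (hr : ∀ j, r j ∣ Fintype.card F - 1)
    (hr_dvd : ∀ j : Fin n, r j.castSucc ∣ r j.succ)
    (hχ : ∀ m, m ∣ r (Fin.last n) → orderOf (χ m) = m) (p : Datum F r) :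
    charSum χ p OnePoint.infty = inftySum r p.1 (degF p) := by
  classical
  refine Eq.trans ?_ (sum_charTuple hr hr_dvd hχ fun ψ =>
    if pairing F (degF p) ψ = 1 then ∏ j, ψ j (p.1 j) else 0)
  refine Finset.sum_congr rfl fun s hs => Finset.sum_congr rfl fun ω _ => ?_
  have hs := hχ _ (ell_dvd hr_dvd ((mem_divVectors (ne_zero_of_dvd_card_sub_one hr)).1 hs))
  change χ (ell s) (if _ then _ else _) = _
  have hdvd : ell s ∣ ∑ j, ell s / s j * ω j * degF p j ↔
      pairing F (degF p) (charTuple χ s ω) = 1 := by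
    rw [pairing_charTuple, ← orderOf_dvd_iff_pow_eq_one, hs]
  rw [apply_ite (χ (ell s)), map_leadCoeff hs, MulChar.map_zero]
  exact if_congr hdvd rfl rfl

end

theorem inftySum_congr (c : Fin (n + 1) → Fˣ) {t t' : Fin (n + 1) → ℕ}
    (h : ∀ j, t j + t' j ≡ 0 [MOD r j]) : inftySum r c t = inftySum r c t' := by
  refine Finset.sum_congr rfl fun ψ _ => ?_
  have hmul : pairing F t ψ * pairing F t' ψ = 1 := by
    rw [pairing_apply, pairing_apply, ← Finset.prod_mul_distrib]
    refine Finset.prod_eq_one fun j _ => ?_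
    obtain ⟨k, hk⟩ := Nat.modEq_zero_iff_dvd.1 (h j)
    rw [← pow_add, hk, pow_mul, mem_dualGroup.1 ψ.2 j, one_pow]
  have hiff : pairing F t ψ = 1 ↔ pairing F t' ψ = 1 := by
    rw [eq_inv_of_mul_eq_one_left hmul, inv_eq_one]
  simp only [hiff]

open scoped Classical in
theorem sum_ite_pairing_eq_zero_or (t : Fin (n + 1) → ℕ)
    (h : (Fin (n + 1) → MulChar F ℂ) →* ℂ) :
    (∑ ψ : dualGroup F r, if pairing F t ψ = 1 then h ψ else 0) = 0 ∨
      (∑ ψ : dualGroup F r, if pairing F t ψ = 1 then h ψ else 0) =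
        Nat.card (annihilator F r t) := by
  let g : annihilator F r t →* ℂ :=
    h.comp ((dualGroup F r).subtype.comp (annihilator F r t).subtype)
  have hsum : (∑ ψ : dualGroup F r, if pairing F t ψ = 1 then h ψ else 0) = ∑ ψ, g ψ := by
    rw [← Finset.sum_filter]
    exact Finset.sum_subtype _ (by simp [mem_annihilator]) fun ψ : dualGroup F r => h ψ
  rw [hsum, sum_hom_units, Nat.card_eq_fintype_card]
  split_ifs
  · exact Or.inr rfl
  · exact Or.inl Nat.cast_zero

theorem inftySum_eq_zero_or (c : Fin (n + 1) → Fˣ) (t : Fin (n + 1) → ℕ) :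
    inftySum r c t = 0 ∨ inftySum r c t = Nat.card (annihilator F r t) := by
  simpa only [dualHom_apply, Pi.one_apply, Units.val_one, map_one, Finset.prod_const_one,
    mul_one, inftySum] using sum_ite_pairing_eq_zero_or t (dualHom (r := r) c 1)

theorem localSum_eq_zero_or (c : Fin (n + 1) → Fˣ) {τ : Option (Idx r)} {b : Idx r → F × F}
    (hb : b ∈ typeData F τ) :
    localSum c (fun α => (b α).1) = 0 ∨
      localSum c (fun α => (b α).1) = Nat.card (annihilator F r (typeVec τ)) := by
  classical
  rw [mem_typeData] at hb
  let u (α : Idx r) : Fˣ := if h : (b α).1 = 0 then 1 else Units.mk0 _ h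
  have hsum : localSum c (fun α => (b α).1) = ∑ ψ : dualGroup F r,
      if pairing F (typeVec τ) ψ = 1 then dualHom c u ψ else 0 := by
    refine Finset.sum_congr rfl fun ψ _ => ?_
    split_ifs with hψ
    · rw [dualHom_apply]
      refine congrArg _ (Finset.prod_congr rfl fun α _ => ?_)
      by_cases hα : (b α).1 = 0
      · rw [(hb α).1.1 hα] at hψ
        rw [show pairing F (idxVec α) ψ = 1 from hψ, extChar_one, MulChar.one_apply_coe]
      · simp [extChar, hα, u]
    · cases τ with
      | none => simp [typeVec, pairing_apply] at hψ
      | some α =>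
        have hψ : pairing F (idxVec α) ψ ≠ 1 := hψ
        rw [Finset.prod_eq_zero (Finset.mem_univ α), mul_zero]
        simp [extChar, (hb α).1.2 rfl, hψ]
  rw [hsum]
  exact sum_ite_pairing_eq_zero_or _ _

theorem sum_localSum (hr : ∀ j, r j ≠ 0) (c : Fin (n + 1) → Fˣ) (τ : Option (Idx r)) :
    ∑ b ∈ typeData F τ, localSum c (fun α => (b α).1) = #(typeData F τ) := by
  classical
  have hswap : ∑ b ∈ typeData F τ, localSum c (fun α => (b α).1) =
      ∑ ψ : dualGroup F r, (∏ j, ψ.1 j (c j)) *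
        ∏ α, ∑ b ∈ typeSet F τ α, extChar (pairing F (idxVec α) ψ) b.1 := by
    simp only [localSum]
    rw [Finset.sum_comm]
    simp only [← Finset.mul_sum, Finset.prod_univ_sum, typeData]
  rw [hswap, Fintype.sum_eq_single 1 fun ψ hψ => ?_]
  · simp [extChar_one, MulChar.one_apply_coe, typeData, Fintype.card_piFinset]
  · obtain ⟨α, hα⟩ := exists_pairing_ne_one hr hψ
    rw [Finset.prod_eq_zero (Finset.mem_univ α) (sum_extChar_typeSet hα τ α), mul_zero]

theorem sum_inftySum [DecidableEq F] (t : Fin (n + 1) → ℕ) :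
    ∑ c : Fin (n + 1) → Fˣ, inftySum r c t = Fintype.card (Fin (n + 1) → Fˣ) := by
  classical
  have hswap : ∑ c : Fin (n + 1) → Fˣ, inftySum r c t =
      ∑ ψ : dualGroup F r, if pairing F t ψ = 1 then ∏ j, ∑ u : Fˣ, ψ.1 j u else 0 := by
    simp only [inftySum]
    rw [Finset.sum_comm]
    refine Finset.sum_congr rfl fun ψ _ => ?_
    split_ifs
    · rw [Finset.prod_univ_sum, Fintype.piFinset_univ]
    · exact Finset.sum_const_zero
  rw [hswap, Fintype.sum_eq_single 1 fun ψ hψ => ?_]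
  · simp [MulChar.one_apply_coe]
  · obtain ⟨j, hj⟩ := Function.ne_iff.1 (Subtype.coe_injective.ne hψ)
    have hsum : ∑ u : Fˣ, ψ.1 j u = 0 :=
      sum_hom_units_eq_zero ((ψ.1 j : F →* ℂ).comp (Units.coeHom F)) fun h =>
        hj (MulChar.eq_one_iff.2 (DFunLike.congr_fun h))
    rw [Finset.prod_eq_zero (Finset.mem_univ j) hsum, ite_self]

/-- The proportion of the cases in which a quantity with mean `1` and possible values `0` and `N`
has the value `e`. -/
def frac (N e : ℕ) : ℝ := if e = N then (N : ℝ)⁻¹ else if e = 0 then 1 - (N : ℝ)⁻¹ else 0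

open scoped Classical in
theorem card_filter_eq_frac {β : Type*} (s : Finset β) (S : β → ℂ) {N : ℕ} (hN : N ≠ 0)
    (hS : ∀ b ∈ s, S b = 0 ∨ S b = N) (hsum : ∑ b ∈ s, S b = #s) (e : ℕ) :
    (#{b ∈ s | S b = e} : ℝ) = #s * frac N e := by
  have hcard : (#{b ∈ s | S b = N} : ℝ) = #s * (N : ℝ)⁻¹ := by
    rw [eq_mul_inv_iff_mul_eq₀ (Nat.cast_ne_zero.2 hN)]
    have : ∑ b ∈ s, S b = ∑ b ∈ s with S b = N, (N : ℂ) := by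
      rw [Finset.sum_filter]
      refine Finset.sum_congr rfl fun b hb => ?_
      rcases hS b hb with h | h <;> simp [h]
    rw [this, Finset.sum_const, nsmul_eq_mul] at hsum
    exact_mod_cast hsum
  unfold frac
  split_ifs with heN he0
  · rw [heN, hcard]
  · have hfilter : {b ∈ s | S b = e} = {b ∈ s | ¬S b = N} := by
      refine Finset.filter_congr fun b hb => ?_
      rcases hS b hb with h | h <;> simp [h, he0, hN, eq_comm (a := (0 : ℂ))]
    rw [hfilter, mul_sub, mul_one, ← hcard, eq_sub_iff_add_eq']
    exact_mod_cast Finset.card_filter_add_card_filter_not (s := s) (fun b => S b = N)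
  · rw [mul_zero, Nat.cast_eq_zero, Finset.card_eq_zero, Finset.filter_eq_empty_iff]
    intro b hb h
    rcases hS b hb with h' | h' <;> rw [h'] at h
    · exact he0 (by exact_mod_cast h.symm)
    · exact heN (by exact_mod_cast h.symm)

end LocalSums

section MainTerm

variable {n : ℕ} {r : Fin (n + 1) → ℕ}

theorem toGroup_typeVec_none : toGroup r (typeVec (none : Option (Idx r))) = 0 :=
  toGroup_eq_zero_iff.2 fun j => dvd_zero (r j)

theorem toGroup_typeVec_bijective (hr : ∀ j, r j ≠ 0) :
    Function.Bijective fun τ : Option (Idx r) => toGroup r (typeVec τ) := by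
  have hne (α : Idx r) : toGroup r (idxVec α) ≠ 0 := fun h =>
    have ⟨j, hj⟩ := α.2
    hj (Nat.eq_zero_of_dvd_of_lt (toGroup_eq_zero_iff.1 h j) (α.1 j).2)
  constructor
  · rintro (_ | α) (_ | β) h
    · rfl
    · exact absurd (h.symm.trans toGroup_typeVec_none) (hne β)
    · exact absurd (h.trans toGroup_typeVec_none) (hne α)
    · refine congrArg some (Subtype.ext (funext fun j => Fin.ext ?_))
      exact ((ZMod.natCast_eq_natCast_iff _ _ _).1 (congrFun h j)).eq_of_lt_of_lt
        (α.1 j).2 (β.1 j).2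
  · intro g
    have (j : Fin (n + 1)) : NeZero (r j) := ⟨hr j⟩
    by_cases hg : ∃ j, (g j).val ≠ 0
    · exact ⟨some ⟨fun j => ⟨(g j).val, ZMod.val_lt _⟩, hg⟩,
        funext fun j => ZMod.natCast_zmod_val (g j)⟩
    · push Not at hg
      exact ⟨none, toGroup_typeVec_none.trans
        (funext fun j => ((ZMod.val_eq_zero (g j)).1 (hg j)).symm)⟩

/-- The order in `G` of a ramification type. -/
def typeOrder (τ : Option (Idx r)) : ℕ := addOrderOf (toGroup r (typeVec τ))

theorem card_typeOrder_eq (hr : ∀ j, r j ≠ 0) (s : ℕ) :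
    #{τ : Option (Idx r) | typeOrder τ = s} = phiG r s := by
  rw [phiG, ← Fintype.card_subtype, ← Nat.card_eq_fintype_card]
  exact Nat.card_congr ((Equiv.ofBijective _ (toGroup_typeVec_bijective hr)).subtypeEquiv
    fun τ => Iff.rfl)

theorem card_idx_add_one (hr : ∀ j, r j ≠ 0) : Fintype.card (Idx r) + 1 = groupOrder r := by
  have (j : Fin (n + 1)) : NeZero (r j) := ⟨hr j⟩
  rw [← Fintype.card_option, Fintype.card_of_bijective (toGroup_typeVec_bijective hr),
    Fintype.card_pi]
  exact Finset.prod_congr rfl fun j _ => ZMod.card (r j)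

theorem groupOrder_ne_zero (hr : ∀ j, r j ≠ 0) : groupOrder r ≠ 0 :=
  Finset.prod_ne_zero_iff.2 fun j _ => hr j

theorem last_dvd_groupOrder (r : Fin (n + 1) → ℕ) : r (Fin.last n) ∣ groupOrder r :=
  Finset.dvd_prod_of_mem r (Finset.mem_univ _)

theorem typeOrder_dvd (hr_dvd : ∀ j : Fin n, r j.castSucc ∣ r j.succ) (τ : Option (Idx r)) :
    typeOrder τ ∣ r (Fin.last n) := by
  rw [typeOrder, addOrderOf_dvd_iff_nsmul_eq_zero, ← toGroup_nsmul, toGroup_eq_zero_iff]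
  exact fun j => (dvd_last hr_dvd j).mul_right _

theorem typeOrder_eq_one_iff (hr : ∀ j, r j ≠ 0) {τ : Option (Idx r)} :
    typeOrder τ = 1 ↔ τ = none := by
  rw [typeOrder, AddMonoid.addOrderOf_eq_one_iff, ← toGroup_typeVec_none]
  exact (toGroup_typeVec_bijective hr).1.eq_iff

theorem sum_typeOrder (hr : ∀ j, r j ≠ 0) (hr_dvd : ∀ j : Fin n, r j.castSucc ∣ r j.succ) :
    ∑ τ : Option (Idx r), (typeOrder τ : ℝ) =
      ∑ s ∈ (r (Fin.last n)).divisors, (s : ℝ) * phiG r s := by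
  rw [← Finset.sum_fiberwise_of_maps_to (g := typeOrder) (t := (r (Fin.last n)).divisors)
    fun τ _ => Nat.mem_divisors.2 ⟨typeOrder_dvd hr_dvd τ, hr _⟩]
  refine Finset.sum_congr rfl fun s _ => ?_
  rw [Finset.sum_congr rfl fun τ hτ => by rw [(Finset.mem_filter.1 hτ).2], Finset.sum_const,
    card_typeOrder_eq hr, nsmul_eq_mul, mul_comm]

theorem frac_zero {N o g : ℕ} (h : N * o = g) (hg : g ≠ 0) : frac N 0 = 1 - o / g := by
  subst h
  obtain ⟨hN, ho⟩ := mul_ne_zero_iff.1 hg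
  rw [frac, if_neg hN.symm, if_pos rfl]
  push_cast
  field_simp

theorem frac_div {N o g s : ℕ} (h : N * o = g) (hg : g ≠ 0) (hs : s ∣ g) :
    frac N (g / s) = if o = s then (s : ℝ) / g else 0 := by
  have hs0 : s ≠ 0 := ne_zero_of_dvd_ne_zero hg hs
  have he0 : g / s ≠ 0 := (Nat.div_pos (Nat.le_of_dvd hg.bot_lt hs) hs0.bot_lt).ne'
  have hiff : g / s = N ↔ o = s := by
    rw [Nat.div_eq_iff_eq_mul_left hs0.bot_lt hs, ← h,
      mul_right_inj' (left_ne_zero_of_mul (h.trans_ne hg))]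
  rw [frac, if_neg he0]
  split_ifs with hN ho ho
  · rw [← h, ← ho, Nat.cast_mul, div_mul_cancel_right₀ (Nat.cast_ne_zero.2 (ho ▸ hs0))]
  · exact absurd (hiff.1 hN) ho
  · exact absurd (hiff.2 ho) hN
  · rfl

theorem injOn_div_of_forall_dvd {g : ℕ} (hg : g ≠ 0) {D : Set ℕ} (hD : ∀ s ∈ D, s ∣ g) :
    Set.InjOn (g / ·) D := fun s hs t ht h => by
  rw [← Nat.div_div_self (hD s hs) hg, ← Nat.div_div_self (hD t ht) hg]
  exact congrArg (g / ·) h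

section

variable (F : Type*) [Fintype F]

/-- The proportion of the ramification type `τ` at a point, relative to the unramified type. -/
def weight {ι : Type*} : Option ι → ℝ
  | none => 1
  | some _ => (Fintype.card F : ℝ)⁻¹

/-- The sum of the `weight`s of all ramification types. -/
def totalWeight (r : Fin (n + 1) → ℕ) : ℝ := ∑ τ : Option (Idx r), weight F τ

theorem totalWeight_eq [Nonempty F] (hr : ∀ j, r j ≠ 0) :
    totalWeight F r = ((Fintype.card F : ℝ) + groupOrder r - 1) / Fintype.card F := by
  have hq : (Fintype.card F : ℝ) ≠ 0 := by simp
  simp only [totalWeight, Fintype.sum_option, weight, Finset.sum_const, Finset.card_univ,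
    nsmul_eq_mul, ← card_idx_add_one hr, Nat.cast_add, Nat.cast_one]
  field_simp
  ring

variable {F}

theorem weight_pos [Nonempty F] {ι : Type*} : ∀ τ : Option ι, 0 < weight F τ
  | none => one_pos
  | some _ => inv_pos.2 (Nat.cast_pos.2 Fintype.card_pos)

theorem inv_card_le_weight [Nonempty F] {ι : Type*} :
    ∀ τ : Option ι, (Fintype.card F : ℝ)⁻¹ ≤ weight F τ
  | none => inv_le_one_of_one_le₀ (Nat.one_le_cast.2 Fintype.card_pos)
  | some _ => le_rfl

theorem totalWeight_pos [Nonempty F] : 0 < totalWeight F r :=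
  Finset.sum_pos (fun τ _ => weight_pos τ) ⟨none, Finset.mem_univ _⟩

theorem card_add_groupOrder_sub_one_ne_zero [Nontrivial F] :
    (Fintype.card F : ℝ) + groupOrder r - 1 ≠ 0 := by
  have hq : (1 : ℝ) < Fintype.card F := Nat.one_lt_cast.2 Fintype.one_lt_card
  have : (0 : ℝ) ≤ groupOrder r := Nat.cast_nonneg _
  linarith

theorem prod_comp_eq_prod_pow_mult {M : Type*} [CommMonoid M] {e : OnePoint F → ℕ} {s : Finset ℕ}
    (hs : ∀ x, e x ∈ s) (f : ℕ → M) : ∏ x, f (e x) = ∏ v ∈ s, f v ^ mult e v := by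
  rw [← Finset.prod_fiberwise_of_maps_to fun x _ => hs x]
  refine Finset.prod_congr rfl fun v _ => ?_
  rw [Finset.prod_congr rfl fun x hx => by rw [(Finset.mem_filter.1 hx).2],
    Finset.prod_const, mult, Nat.card_eq_fintype_card, Fintype.card_subtype]

end

variable {F : Type*} [Field F] [Fintype F]

variable (F) in
/-- The sum over all ramification types of the proportion of the cases in which the character sum
at a point is `e`, weighted by `weight`. -/
def valueWeight (r : Fin (n + 1) → ℕ) (e : ℕ) : ℝ :=
  ∑ τ : Option (Idx r), weight F τ * frac (Nat.card (annihilator F r (typeVec τ))) e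

theorem valueWeight_div (hr : ∀ j, r j ∣ Fintype.card F - 1) {s : ℕ} (hs : s ∣ groupOrder r) :
    valueWeight F r (groupOrder r / s) =
      (∑ τ : Option (Idx r) with typeOrder τ = s, weight F τ) * (s / groupOrder r) := by
  have hg := groupOrder_ne_zero (ne_zero_of_dvd_card_sub_one hr)
  rw [valueWeight, Finset.sum_filter, Finset.sum_mul]
  refine Finset.sum_congr rfl fun τ _ => ?_
  rw [frac_div (card_annihilator_mul_addOrderOf hr _) hg hs, ite_zero_mul, mul_ite_zero]
  rfl

theorem valueWeight_zero (hr : ∀ j, r j ∣ Fintype.card F - 1) :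
    valueWeight F r 0 = ∑ τ : Option (Idx r), weight F τ * (1 - typeOrder τ / groupOrder r) :=
  Finset.sum_congr rfl fun _ _ => congrArg _ <|
    frac_zero (card_annihilator_mul_addOrderOf hr _)
      (groupOrder_ne_zero (ne_zero_of_dvd_card_sub_one hr))

theorem valueWeight_groupOrder_div_totalWeight (hr : ∀ j, r j ∣ Fintype.card F - 1) :
    valueWeight F r (groupOrder r) / totalWeight F r =
      (Fintype.card F : ℝ) / (groupOrder r * (Fintype.card F + groupOrder r - 1)) := by
  have hr0 := ne_zero_of_dvd_card_sub_one hr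
  have hvalue := valueWeight_div hr (one_dvd _)
  rw [Nat.div_one, Finset.sum_filter, Fintype.sum_eq_single none fun τ hτ =>
    if_neg (hτ ∘ (typeOrder_eq_one_iff hr0).1), if_pos ((typeOrder_eq_one_iff hr0).2 rfl), weight,
    one_mul, Nat.cast_one] at hvalue
  have := card_add_groupOrder_sub_one_ne_zero (F := F) (r := r)
  have : (Fintype.card F : ℝ) ≠ 0 := by simp
  rw [hvalue, totalWeight_eq F hr0]
  field_simp

theorem valueWeight_groupOrder_div_div_totalWeight (hr : ∀ j, r j ∣ Fintype.card F - 1) {s : ℕ}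
    (hs : s ∣ groupOrder r) (hs1 : s ≠ 1) :
    valueWeight F r (groupOrder r / s) / totalWeight F r =
      (s : ℝ) * phiG r s / (groupOrder r * (Fintype.card F + groupOrder r - 1)) := by
  have hr0 := ne_zero_of_dvd_card_sub_one hr
  have hweight : ∀ τ ∈ ({τ | typeOrder τ = s} : Finset (Option (Idx r))),
      weight F τ = (Fintype.card F : ℝ)⁻¹ := by
    rintro (_ | β) hτ
    · exact absurd ((Finset.mem_filter.1 hτ).2.symm.trans ((typeOrder_eq_one_iff hr0).2 rfl)) hs1
    · rfl
  have := card_add_groupOrder_sub_one_ne_zero (F := F) (r := r)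
  have : (Fintype.card F : ℝ) ≠ 0 := by simp
  rw [valueWeight_div hr hs, Finset.sum_congr rfl hweight, Finset.sum_const,
    card_typeOrder_eq hr0, nsmul_eq_mul, totalWeight_eq F hr0]
  field_simp

theorem valueWeight_zero_div_totalWeight (hr : ∀ j, r j ∣ Fintype.card F - 1)
    (hr_dvd : ∀ j : Fin n, r j.castSucc ∣ r j.succ) :
    valueWeight F r 0 / totalWeight F r =
      (((groupOrder r : ℝ) - 1) * (Fintype.card F + groupOrder r) -
        ∑ s ∈ (r (Fin.last n)).divisors, (s : ℝ) * phiG r s + 1) /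
        (groupOrder r * (Fintype.card F + groupOrder r - 1)) := by
  have hr0 := ne_zero_of_dvd_card_sub_one hr
  have hidx : (Fintype.card (Idx r) : ℝ) = groupOrder r - 1 :=
    eq_sub_of_add_eq (by exact_mod_cast card_idx_add_one hr0)
  have := card_add_groupOrder_sub_one_ne_zero (F := F) (r := r)
  have : (Fintype.card F : ℝ) ≠ 0 := by simp
  have : (groupOrder r : ℝ) ≠ 0 := Nat.cast_ne_zero.2 (groupOrder_ne_zero hr0)
  rw [valueWeight_zero hr, ← sum_typeOrder hr0 hr_dvd, totalWeight_eq F hr0, Fintype.sum_option,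
    Fintype.sum_option, (typeOrder_eq_one_iff hr0).2 rfl]
  simp only [weight]
  rw [← Finset.mul_sum, Finset.sum_sub_distrib, ← Finset.sum_div, Finset.sum_const,
    Finset.card_univ, nsmul_eq_mul, mul_one, hidx]
  field_simp
  push_cast
  ring

theorem mainTerm_eq (hr : ∀ j, r j ∣ Fintype.card F - 1)
    (hr_dvd : ∀ j : Fin n, r j.castSucc ∣ r j.succ) (e : OnePoint F → ℕ)
    (he : ∀ x, e x = 0 ∨ ∃ s, s ∣ r (Fin.last n) ∧ e x = groupOrder r / s) :
    mainTerm r e = ∏ x, valueWeight F r (e x) / totalWeight F r := by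
  have hr0 := ne_zero_of_dvd_card_sub_one hr
  have hg := groupOrder_ne_zero hr0
  set D := (r (Fin.last n)).divisors
  have hDg (s) (hs : s ∈ D) : s ∣ groupOrder r :=
    (Nat.dvd_of_mem_divisors hs).trans (last_dvd_groupOrder r)
  have hzero : 0 ∉ D.image (groupOrder r / ·) := fun h => by
    obtain ⟨s, hs, hs0⟩ := Finset.mem_image.1 h
    exact (Nat.div_pos (Nat.le_of_dvd hg.bot_lt (hDg s hs))
      (Nat.pos_of_dvd_of_pos (hDg s hs) hg.bot_lt)).ne' hs0
  have hmem (x) : e x ∈ insert 0 (D.image (groupOrder r / ·)) :=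
    Finset.mem_insert.2 <| (he x).imp_right fun ⟨s, hs, hes⟩ =>
      Finset.mem_image.2 ⟨s, Nat.mem_divisors.2 ⟨hs, hr0 _⟩, hes.symm⟩
  rw [prod_comp_eq_prod_pow_mult hmem (fun v => valueWeight F r v / totalWeight F r),
    Finset.prod_insert hzero, Finset.prod_image (injOn_div_of_forall_dvd hg hDg),
    ← Finset.mul_prod_erase D _ (Nat.one_mem_divisors.2 (hr0 _)), Nat.div_one,
    valueWeight_zero_div_totalWeight hr hr_dvd, valueWeight_groupOrder_div_totalWeight hr,
    ← mul_assoc, mainTerm]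
  refine congrArg _ (Finset.prod_congr rfl fun s hs => ?_)
  obtain ⟨hs1, hs⟩ := Finset.mem_erase.1 hs
  rw [valueWeight_groupOrder_div_div_totalWeight hr (hDg s hs) hs1]

end MainTerm

section Strata

/-- The degrees `d` at ramification type `τ` of the point at infinity: one less than `d β` at `β`
if `τ = some β`, in truncated subtraction. -/
def lowerDeg {ι : Type*} [DecidableEq ι] (d : ι → ℕ) : Option ι → ι → ℕ
  | none => d
  | some β => Function.update d β (d β - 1)

variable {ι : Type*} [DecidableEq ι] {d : ι → ℕ}

theorem lowerDeg_injective (hd : ∀ α, 1 ≤ d α) : Function.Injective (lowerDeg d) := by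
  have hpred (τ : Option ι) (β : ι) : lowerDeg d τ β = d β - 1 ↔ τ = some β := by
    have := hd β
    rcases τ with _ | γ
    · simp only [lowerDeg, reduceCtorEq, iff_false]
      omega
    · rcases eq_or_ne β γ with rfl | h
      · simp [lowerDeg]
      · simp only [lowerDeg, Function.update_of_ne h, Option.some_inj, h.symm, iff_false]
        omega
  intro τ τ' h
  ext β
  rw [← hpred, ← hpred, h]

theorem le_lowerDeg {m : ℕ} (hm : ∀ α, m + 1 ≤ d α) (τ : Option ι) (α : ι) :
    m ≤ lowerDeg d τ α := by
  have := hm α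
  rcases τ with _ | β
  · exact Nat.le_of_succ_le this
  · rw [lowerDeg, Function.update_apply]
    split_ifs with h
    · subst h
      omega
    · omega

variable [Fintype ι]

theorem sum_mul_lowerDeg_some {β : ι} (hβ : 1 ≤ d β) (k : ι → ℕ) :
    ∑ α, k α * lowerDeg d (some β) α + k β = ∑ α, k α * d α := by
  rw [← Finset.add_sum_erase _ _ (Finset.mem_univ β),
    ← Finset.add_sum_erase _ _ (Finset.mem_univ β), Finset.sum_congr rfl fun α hα => by
      rw [lowerDeg, Function.update_of_ne (Finset.ne_of_mem_erase hα)],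
    lowerDeg, Function.update_self, add_right_comm, ← Nat.mul_succ, Nat.succ_eq_add_one,
    Nat.sub_add_cancel hβ]

variable {F : Type*} [Field F] [Fintype F]

theorem card_pow_sum_lowerDeg (hd : ∀ α, 1 ≤ d α) (τ : Option ι) :
    (Fintype.card F : ℝ) ^ ∑ α, lowerDeg d τ α = weight F τ * Fintype.card F ^ ∑ α, d α := by
  rcases τ with _ | β
  · exact (one_mul _).symm
  · have hsum := sum_mul_lowerDeg_some (hd β) 1
    simp only [Pi.one_apply, one_mul] at hsum
    have : (Fintype.card F : ℝ) ≠ 0 := by simp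
    rw [weight, ← hsum, pow_succ]
    field_simp

variable (F) in
/-- The jets of a family of polynomials at all the points. -/
def jets (f : ι → F[X]) (x : F) (α : ι) : F × F := jet F (f α) x

open scoped Classical in
/-- The number of families of monic polynomials of degrees `d` with jets `a` whose product is
squarefree away from the points of `F`. -/
def jetCount (d : ι → ℕ) (a : F → ι → F × F) : ℕ :=
  #{f ∈ tuples F d | SquarefreeAway (jetModulus F) (∏ α, f α) ∧ jets F f = a}

variable (F ι) in
theorem exists_pos_abs_jetCount_div_sub_le : ∃ L > 0, ∃ K : ℝ, ∀ (m : ℕ) (d : ι → ℕ)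
    (a : F → ι → F × F), (∀ α, m ≤ d α) →
    |(jetCount d a : ℝ) / Fintype.card F ^ ∑ α, d α - L| ≤ K * (sqrtCard F)⁻¹ ^ m := by
  classical
  obtain ⟨L, hL, K, h⟩ := exists_pos_abs_tupleFreq_sub_le ι (monic_jetModulus (F := F))
  refine ⟨L, hL, K, fun m d a hm => ?_⟩
  choose A hA using fun α => jet_surjective (K := F) fun x => a x α
  have hcount : jetCount d a = tupleCount (jetModulus F) d A := by
    refine congrArg Finset.card (Finset.filter_congr fun f _ => and_congr_right fun _ => ?_)
    simp only [jetModulus_dvd_sub_iff, hA, jets, funext_iff]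
    exact forall_comm
  rw [hcount]
  exact h m d A hm

variable {C : Type*}

/-- The pairs of `c : C` and a family of monic polynomials of degrees `lowerDeg d τ`, for a
ramification type `τ` which occurs at infinity, whose product is squarefree away from the points of
`F`, such that the type, `c` and the jets of the family form an element of `I`. -/
def jetLocus (d : ι → ℕ) (I : Finset (Option ι × C × (F → ι → F × F))) : Set (C × (ι → F[X])) :=
  {p | ∃ τ, (∀ β, τ = some β → 1 ≤ d β) ∧ p.2 ∈ tuples F (lowerDeg d τ) ∧
    SquarefreeAway (jetModulus F) (∏ α, p.2 α) ∧ (τ, p.1, jets F p.2) ∈ I}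

theorem ncard_jetLocus (hd : ∀ α, 1 ≤ d α) (I : Finset (Option ι × C × (F → ι → F × F))) :
    (jetLocus d I).ncard = ∑ i ∈ I, jetCount (lowerDeg d i.1) i.2.2 := by
  classical
  let fiber (i : Option ι × C × (F → ι → F × F)) : Finset (C × (ι → F[X])) :=
    {i.2.1} ×ˢ {f ∈ tuples F (lowerDeg d i.1) |
      SquarefreeAway (jetModulus F) (∏ α, f α) ∧ jets F f = i.2.2}
  have hunion : jetLocus d I = I.biUnion fiber := by
    ext p
    simp only [jetLocus, Set.mem_ofPred_eq, Finset.coe_biUnion, Set.mem_iUnion, fiber,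
      Finset.mem_coe, Finset.mem_product, Finset.mem_singleton, Finset.mem_filter]
    constructor
    · rintro ⟨τ, -, hp, haway, hI⟩
      exact ⟨_, hI, rfl, hp, haway, rfl⟩
    · rintro ⟨⟨τ, c, a⟩, hI, rfl, hp, haway, rfl⟩
      exact ⟨τ, fun β _ => hd β, hp, haway, hI⟩
  have hdisj : (I : Set (Option ι × C × (F → ι → F × F))).PairwiseDisjoint fiber := by
    refine fun i _ i' _ hne => Finset.disjoint_left.2 fun p hp hp' => hne ?_
    simp only [fiber, Finset.mem_product, Finset.mem_singleton, Finset.mem_filter,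
      mem_tuples] at hp hp'
    exact Prod.ext
      (lowerDeg_injective hd (funext fun α => (hp.2.1 α).2.symm.trans (hp'.2.1 α).2))
      (Prod.ext (hp.1.symm.trans hp'.1) (hp.2.2.2.symm.trans hp'.2.2.2))
  rw [hunion, Set.ncard_coe_finset, Finset.card_biUnion hdisj]
  exact Finset.sum_congr rfl fun i _ => by
    rw [Finset.card_product, Finset.card_singleton, one_mul, jetCount]

variable (F ι C) in
theorem exists_pos_abs_ncard_jetLocus_div_sub_le [Finite C] : ∃ L > 0, ∃ K : ℝ, ∀ (m : ℕ)
    (d : ι → ℕ) (I : Finset (Option ι × C × (F → ι → F × F))), (∀ α, m + 1 ≤ d α) →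
    |((jetLocus d I).ncard : ℝ) / Fintype.card F ^ ∑ α, d α - L * ∑ i ∈ I, weight F i.1| ≤
      K * (sqrtCard F)⁻¹ ^ m := by
  classical
  have := Fintype.ofFinite C
  obtain ⟨L, hL, K, h⟩ := exists_pos_abs_jetCount_div_sub_le ι F
  have hweight (τ : Option ι) : weight F τ ≤ 1 := by
    rcases τ with _ | _
    · exact le_rfl
    · exact inv_le_one_of_one_le₀ (Nat.one_le_cast.2 Fintype.card_pos)
  refine ⟨L, hL, Fintype.card (Option ι × C × (F → ι → F × F)) * K, fun m d I hm => ?_⟩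
  have hd (α : ι) : 1 ≤ d α := (Nat.le_add_left 1 m).trans (hm α)
  have hfreq (i : Option ι × C × (F → ι → F × F)) :
      |(jetCount (lowerDeg d i.1) i.2.2 : ℝ) / Fintype.card F ^ ∑ α, d α - L * weight F i.1| ≤
        K * (sqrtCard F)⁻¹ ^ m := by
    have hi := h m (lowerDeg d i.1) i.2.2 (le_lowerDeg hm i.1)
    have hpos := weight_pos (F := F) i.1
    have hq : (Fintype.card F : ℝ) ≠ 0 := by simp
    rw [card_pow_sum_lowerDeg hd] at hi
    calc _ = weight F i.1 * |(jetCount (lowerDeg d i.1) i.2.2 : ℝ) /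
          (weight F i.1 * Fintype.card F ^ ∑ α, d α) - L| := by
          rw [← abs_of_pos hpos, ← abs_mul, abs_of_pos hpos]
          field_simp
      _ ≤ _ := (mul_le_of_le_one_left (abs_nonneg _) (hweight i.1)).trans hi
  rw [ncard_jetLocus hd, Nat.cast_sum, Finset.sum_div, Finset.mul_sum, ← Finset.sum_sub_distrib]
  calc _ ≤ ∑ _i ∈ I, K * (sqrtCard F)⁻¹ ^ m :=
        (Finset.abs_sum_le_sum_abs _ _).trans (Finset.sum_le_sum fun i _ => hfreq i)
    _ ≤ ∑ _i, K * (sqrtCard F)⁻¹ ^ m :=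
        Finset.sum_le_univ_sum_of_nonneg fun i => (abs_nonneg _).trans (hfreq i)
    _ = _ := by rw [Finset.sum_const, nsmul_eq_mul, Finset.card_univ, mul_assoc]

end Strata

section Frequencies

variable {F : Type*} [Field F] [Fintype F] {ι C : Type*} [Fintype ι] [DecidableEq ι] [Finite C]

theorem jetLocus_finite (d : ι → ℕ) (I : Finset (Option ι × C × (F → ι → F × F))) :
    (jetLocus d I).Finite := by
  refine (Set.finite_iUnion fun τ =>
    Set.finite_univ.prod (tuples F (lowerDeg d τ)).finite_toSet).subset ?_
  rintro p ⟨τ, -, hp, -⟩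
  exact Set.mem_iUnion.2 ⟨τ, Set.mem_univ _, hp⟩

theorem ncard_jetLocus_mono {d : ι → ℕ} {I J : Finset (Option ι × C × (F → ι → F × F))}
    (h : I ⊆ J) : (jetLocus d I).ncard ≤ (jetLocus d J).ncard := by
  refine Set.ncard_le_ncard ?_ (jetLocus_finite d J)
  rintro p ⟨τ, hτ, hp, haway, hI⟩
  exact ⟨τ, hτ, hp, haway, h hI⟩

theorem abs_div_sub_div_le {x y X Y ε : ℝ} (hy : 0 ≤ y) (hyx : y ≤ x) (hX : 0 < X)
    (hxX : |x - X| ≤ ε) (hyY : |y - Y| ≤ ε) : |y / x - Y / X| ≤ 2 * ε / X := by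
  have hratio : y / x * x = y := div_mul_cancel_of_imp fun h => by linarith
  have hdiff : (y / x - Y / X) * X = (y - Y) - y / x * (x - X) := by
    rw [sub_mul, div_mul_cancel₀ _ hX.ne', mul_sub, hratio]
    ring
  have hle : |y / x * (x - X)| ≤ ε := by
    rw [abs_mul, abs_of_nonneg (div_nonneg hy (hy.trans hyx))]
    exact (mul_le_of_le_one_left (abs_nonneg _) (div_le_one_of_le₀ hyx (hy.trans hyx))).trans hxX
  rw [le_div_iff₀ hX, ← abs_of_pos hX, ← abs_mul, abs_of_pos hX, hdiff, two_mul]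
  exact (abs_sub _ _).trans (add_le_add hyY hle)

theorem exists_abs_ncard_jetLocus_div_sub_le {J : Finset (Option ι × C × (F → ι → F × F))}
    (hJ : J.Nonempty) : ∃ K : ℝ, ∀ (m : ℕ) (d : ι → ℕ), ∀ I ⊆ J, (∀ α, m ≤ d α) →
    |((jetLocus d I).ncard : ℝ) / (jetLocus d J).ncard -
      (∑ i ∈ I, weight F i.1) / ∑ i ∈ J, weight F i.1| ≤ K * (sqrtCard F)⁻¹ ^ m := by
  obtain ⟨L, hL, K, h⟩ := exists_pos_abs_ncard_jetLocus_div_sub_le ι F C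
  have hJ_pos : 0 < ∑ i ∈ J, weight F i.1 := Finset.sum_pos (fun i _ => weight_pos i.1) hJ
  refine ⟨max 1 (2 * (K * sqrtCard F) / (L * ∑ i ∈ J, weight F i.1)), fun m d I hI hm => ?_⟩
  have hncard : ((jetLocus d I).ncard : ℝ) ≤ (jetLocus d J).ncard :=
    Nat.cast_le.2 (ncard_jetLocus_mono hI)
  rcases m with _ | m
  · have hsum : ∑ i ∈ I, weight F i.1 ≤ ∑ i ∈ J, weight F i.1 :=
      Finset.sum_le_sum_of_subset_of_nonneg hI fun i _ _ => (weight_pos i.1).le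
    have hI_nonneg : 0 ≤ ∑ i ∈ I, weight F i.1 :=
      Finset.sum_nonneg fun i _ => (weight_pos i.1).le
    rw [pow_zero, mul_one]
    exact (abs_sub_le_of_nonneg_of_le (by positivity) (div_le_one_of_le₀ hncard (by positivity))
      (by positivity) (div_le_one_of_le₀ hsum hJ_pos.le)).trans (le_max_left _ _)
  · have hQ : (0 : ℝ) < Fintype.card F ^ ∑ α, d α := by positivity
    have hratio := abs_div_sub_div_le (by positivity) (div_le_div_of_nonneg_right hncard hQ.le)
      (mul_pos hL hJ_pos) (h m d J hm) (h m d I hm)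
    rw [div_div_div_cancel_right₀ hQ.ne', mul_div_mul_left _ _ hL.ne'] at hratio
    have hpow : (sqrtCard F)⁻¹ ^ m = sqrtCard F * (sqrtCard F)⁻¹ ^ (m + 1) := by
      rw [pow_succ', mul_inv_cancel_left₀ sqrtCard_pos.ne']
    rw [hpow] at hratio
    exact (hratio.trans_eq (by ring)).trans (mul_le_mul_of_nonneg_right (le_max_right _ _)
      (pow_nonneg inv_sqrtCard_pos.le _))

theorem exists_ncard_jetLocus_div_eq (J : Finset (Option ι × C × (F → ι → F × F))) :
    ∃ K : ℝ, ∀ (m : ℕ) (d : ι → ℕ), ∀ I ⊆ J, (∀ α, m ≤ d α) →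
      ∃ δ : ℝ, |δ| ≤ K * (sqrtCard F)⁻¹ ^ m ∧
        ((jetLocus d I).ncard : ℝ) / (jetLocus d J).ncard =
          (∑ i ∈ I, weight F i.1) / (∑ i ∈ J, weight F i.1) * (1 + δ) := by
  rcases J.eq_empty_or_nonempty with rfl | hJ
  · refine ⟨0, fun m d I hI _ => ⟨0, by simp, ?_⟩⟩
    simp [Finset.subset_empty.1 hI, jetLocus]
  obtain ⟨K, h⟩ := exists_abs_ncard_jetLocus_div_sub_le hJ
  have hJ_pos : 0 < ∑ i ∈ J, weight F i.1 := Finset.sum_pos (fun i _ => weight_pos i.1) hJ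
  refine ⟨K * ((∑ i ∈ J, weight F i.1) * Fintype.card F), fun m d I hI hm => ?_⟩
  have hd := h m d I hI hm
  rcases I.eq_empty_or_nonempty with rfl | ⟨i, hi⟩
  · refine ⟨0, ?_, by simp [jetLocus]⟩
    have := (abs_nonneg _).trans hd
    rw [abs_zero, mul_right_comm]
    positivity
  have hI_ge : (Fintype.card F : ℝ)⁻¹ ≤ ∑ i ∈ I, weight F i.1 := (inv_card_le_weight i.1).trans
    (Finset.single_le_sum (f := fun i => weight F i.1) (fun i _ => (weight_pos i.1).le) hi)
  have hI_pos : 0 < ∑ i ∈ I, weight F i.1 := (by positivity : (0 : ℝ) < _).trans_le hI_ge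
  generalize ∑ i ∈ I, weight F i.1 = W, ∑ i ∈ J, weight F i.1 = W₀,
    ((jetLocus d I).ncard : ℝ) / (jetLocus d J).ncard = R at *
  refine ⟨(R - W / W₀) * (W₀ * W⁻¹), ?_, by field_simp; ring⟩
  rw [abs_mul, abs_of_pos (by positivity : 0 < W₀ * W⁻¹), mul_right_comm]
  have hinv : W⁻¹ ≤ Fintype.card F := inv_le_of_inv_le₀ (by positivity) hI_ge
  exact mul_le_mul hd (mul_le_mul_of_nonneg_left hinv hJ_pos.le) (by positivity)
    ((abs_nonneg _).trans hd)

end Frequencies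

section Loci

variable {F : Type*} [Field F] [Fintype F]

/-- The possible jets, at a point, of a family whose product has no double root there. -/
def admissibleData (F ι : Type*) [Field F] [Fintype F] [Fintype ι] [DecidableEq ι] :
    Finset (ι → F × F) :=
  letI := Classical.decEq F
  Finset.univ.biUnion (typeData F)

/-- The number of possible jets of a family at an unramified point. -/
def unramifiedCount (F ι : Type*) [Fintype F] [Fintype ι] : ℝ :=
  ((Fintype.card F - 1) * Fintype.card F) ^ Fintype.card ι

section

variable {ι : Type*} [Fintype ι] [DecidableEq ι]

theorem mem_admissibleData {b : ι → F × F} : b ∈ admissibleData F ι ↔ ∃ τ, b ∈ typeData F τ := by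
  simp [admissibleData]

theorem typeData_disjoint {τ τ' : Option ι} (h : τ ≠ τ') :
    Disjoint (typeData F τ) (typeData F τ') := by
  refine Finset.disjoint_left.2 fun b hb hb' => h (Option.ext fun α => ?_)
  exact ((mem_typeData.1 hb α).1.symm.trans (mem_typeData.1 hb' α).1)

open scoped Classical in
theorem card_filter_admissibleData (P : (ι → F × F) → Prop) :
    #{b ∈ admissibleData F ι | P b} = ∑ τ, #{b ∈ typeData F τ | P b} := by
  rw [admissibleData, Finset.filter_biUnion, Finset.card_biUnion]
  exact fun τ _ τ' _ h => Finset.disjoint_filter_filter (typeData_disjoint h)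

omit [Fintype ι] in
theorem card_typeSet (τ : Option ι) (α : ι) : (#(typeSet F τ α) : ℝ) =
    ((Fintype.card F - 1) * Fintype.card F) * if τ = some α then (Fintype.card F : ℝ)⁻¹ else 1 := by
  classical
  have hcompl : (#({0}ᶜ : Finset F) : ℝ) = Fintype.card F - 1 := by
    rw [Finset.card_compl, Finset.card_singleton, Nat.cast_sub Fintype.card_pos, Nat.cast_one]
  have : (Fintype.card F : ℝ) ≠ 0 := by simp
  rw [typeSet]
  split_ifs <;> rw [Finset.card_product] <;> push_cast [hcompl, Finset.card_univ]
  · field_simp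
    simp
  · simp

theorem card_typeData (τ : Option ι) :
    (#(typeData F τ) : ℝ) = unramifiedCount F ι * weight F τ := by
  rw [typeData, Fintype.card_piFinset, Nat.cast_prod,
    Finset.prod_congr rfl fun α _ => card_typeSet τ α, Finset.prod_mul_distrib, Finset.prod_const,
    Finset.card_univ]
  cases τ <;> simp [weight, unramifiedCount]

end

variable {n : ℕ} {r : Fin (n + 1) → ℕ}

variable (F r) in
open scoped Classical in
/-- The triples of a type at infinity, a vector of constants and jets which are attained by elements
of `Fhat`. -/
def admissibleTriples : Finset (Option (Idx r) × (Fin (n + 1) → Fˣ) × (F → Idx r → F × F)) :=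
  {i | ∀ x, i.2.2 x ∈ admissibleData F (Idx r)}

variable (r) in
open scoped Classical in
/-- The triples in `admissibleTriples` for which the character sum at each point `x` is `e x`. -/
def matchingTriples (e : OnePoint F → ℕ) :
    Finset (Option (Idx r) × (Fin (n + 1) → Fˣ) × (F → Idx r → F × F)) :=
  {i | inftySum r i.2.1 (typeVec i.1) = e OnePoint.infty ∧
    ∀ x, i.2.2 x ∈ admissibleData F (Idx r) ∧
      localSum i.2.1 (fun α => (i.2.2 x α).1) = e (OnePoint.some x)}

theorem mem_matchingTriples {e : OnePoint F → ℕ}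
    {i : Option (Idx r) × (Fin (n + 1) → Fˣ) × (F → Idx r → F × F)} :
    i ∈ matchingTriples r e ↔ inftySum r i.2.1 (typeVec i.1) = e OnePoint.infty ∧
      ∀ x, i.2.2 x ∈ admissibleData F (Idx r) ∧
        localSum i.2.1 (fun α => (i.2.2 x α).1) = e (OnePoint.some x) := by
  classical
  simp only [matchingTriples, Finset.mem_filter, Finset.mem_univ, true_and]

theorem matchingTriples_subset (e : OnePoint F → ℕ) :
    matchingTriples r e ⊆ admissibleTriples F r := fun i hi => by
  classical
  exact Finset.mem_filter.2 ⟨Finset.mem_univ i, fun x => ((mem_matchingTriples.1 hi).2 x).1⟩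

theorem Fhat_eq_jetLocus (d : Idx r → ℕ) : Fhat F r d = jetLocus d (admissibleTriples F r) := by
  ext p
  have hadm (hmonic : ∀ α, (p.2 α).Monic) (τ : Option (Idx r)) :
      ((∀ α, Squarefree (p.2 α)) ∧ ∀ α β, α ≠ β → IsCoprime (p.2 α) (p.2 β)) ↔
        SquarefreeAway (jetModulus F) (∏ α, p.2 α) ∧
          (τ, p.1, jets F p.2) ∈ admissibleTriples F r := by
    rw [← squarefree_prod_iff, squarefree_prod_iff_jet_mem_typeData fun α => (hmonic α).ne_zero]
    simp only [admissibleTriples, Finset.mem_filter, Finset.mem_univ, true_and, mem_admissibleData]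
    rfl
  simp only [Fhat, jetLocus, Set.mem_ofPred_eq, mem_tuples]
  constructor
  · rintro ⟨hf, hcop, hdeg | ⟨β, hβ, hdeg⟩⟩
    · exact ⟨none, by simp, fun α => ⟨(hf α).1, hdeg α⟩,
        (hadm (fun α => (hf α).1) none).1 ⟨fun α => (hf α).2, hcop⟩⟩
    · refine ⟨some β, by rintro _ ⟨⟩; omega, fun α => ⟨(hf α).1, ?_⟩,
        (hadm (fun α => (hf α).1) _).1 ⟨fun α => (hf α).2, hcop⟩⟩
      rw [lowerDeg, Function.update_apply]
      split_ifs with h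
      · rw [h]
        omega
      · exact hdeg α h
  · rintro ⟨τ, hτ, hf, h⟩
    obtain ⟨hsq, hcop⟩ := (hadm (fun α => (hf α).1) τ).2 h
    refine ⟨fun α => ⟨(hf α).1, hsq α⟩, hcop, ?_⟩
    rcases τ with _ | β
    · exact Or.inl fun α => (hf α).2
    · refine Or.inr ⟨β, ?_, fun α hα => ?_⟩
      · rw [(hf β).2, lowerDeg, Function.update_self, Nat.sub_add_cancel (hτ β rfl)]
      · rw [(hf α).2, lowerDeg, Function.update_of_ne hα]

theorem degF_add_typeVec {d : Idx r → ℕ} {p : Datum F r} {τ : Option (Idx r)}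
    (hτ : ∀ β, τ = some β → 1 ≤ d β) (hp : p.2 ∈ tuples F (lowerDeg d τ)) (j : Fin (n + 1)) :
    degF p j + typeVec τ j = ∑ α : Idx r, (α.1 j : ℕ) * d α := by
  rw [degF, Finset.sum_congr rfl fun α _ => by rw [(mem_tuples.1 hp α).2]]
  rcases τ with _ | β
  · rfl
  · exact sum_mul_lowerDeg_some (hτ β rfl) fun α : Idx r => (α.1 j : ℕ)

theorem setOf_charSum_eq_jetLocus {χ : ℕ → MulChar F ℂ} (hr : ∀ j, r j ∣ Fintype.card F - 1)
    (hr_dvd : ∀ j : Fin n, r j.castSucc ∣ r j.succ)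
    (hχ : ∀ m, m ∣ r (Fin.last n) → orderOf (χ m) = m) {d : Idx r → ℕ}
    (hd : ∀ j, ∑ α : Idx r, (α.1 j : ℕ) * d α ≡ 0 [MOD r j]) (e : OnePoint F → ℕ) :
    {p ∈ Fhat F r d | ∀ x, charSum χ p x = (e x : ℂ)} = jetLocus d (matchingTriples r e) := by
  ext p
  rw [Fhat_eq_jetLocus, Set.mem_ofPred_eq, jetLocus, jetLocus, Set.mem_ofPred_eq,
    Set.mem_ofPred_eq, ← exists_and_right]
  refine exists_congr fun τ => ?_
  simp only [and_assoc]
  refine and_congr_right fun hτ => and_congr_right fun hp => and_congr_right fun _ => ?_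
  have hinfty : charSum χ p OnePoint.infty = inftySum r p.1 (typeVec τ) := by
    rw [charSum_none hr hr_dvd hχ]
    exact inftySum_congr _ fun j => by rw [degF_add_typeVec hτ hp j]; exact hd j
  have hsome (x : F) :
      charSum χ p (OnePoint.some x) = localSum p.1 fun α => (jets F p.2 x α).1 :=
    charSum_some hr hr_dvd hχ p x
  simp only [admissibleTriples, mem_matchingTriples, Finset.mem_filter, Finset.mem_univ, true_and,
    OnePoint.forall, hinfty, hsome, forall_and]
  exact and_left_comm

open scoped Classical in
theorem sum_eq_of_mem_iff_and_forall_mem {κ C X β : Type*} [Fintype κ] [Fintype C] [Fintype X]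
    [Finite β] (P : κ → C → Prop) (T : C → X → Finset β) {t : X → ℝ}
    (hT : ∀ c x, (#(T c x) : ℝ) = t x) (w : κ → ℝ) {I : Finset (κ × C × (X → β))}
    (hI : ∀ i, i ∈ I ↔ P i.1 i.2.1 ∧ ∀ x, i.2.2 x ∈ T i.2.1 x) :
    ∑ i ∈ I, w i.1 = (∑ k, w k * #{c | P k c}) * ∏ x, t x := by
  have := Fintype.ofFinite β
  have hpi (k : κ) (c : C) : ∑ a : X → β, (if P k c ∧ ∀ x, a x ∈ T c x then w k else 0) =
      (if P k c then w k else 0) * ∏ x, t x := by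
    simp only [ite_and, ← Fintype.mem_piFinset]
    split_ifs
    · rw [← Finset.sum_filter, Finset.filter_univ_mem, Finset.sum_const, Fintype.card_piFinset,
        nsmul_eq_mul, Nat.cast_prod, Finset.prod_congr rfl fun x _ => hT c x, mul_comm]
    · simp
  rw [← Finset.filter_univ_mem I, Finset.sum_filter, Fintype.sum_prod_type, Finset.sum_mul]
  simp only [hI]
  refine Finset.sum_congr rfl fun k _ => ?_
  rw [Fintype.sum_prod_type, Finset.sum_congr rfl fun c _ => hpi k c, ← Finset.sum_mul,
    ← Finset.sum_filter, Finset.sum_const, nsmul_eq_mul, mul_comm (w k)]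

theorem card_admissibleData : (#(admissibleData F (Idx r)) : ℝ) =
    unramifiedCount F (Idx r) * totalWeight F r := by
  classical
  rw [admissibleData, Finset.card_biUnion fun τ _ τ' _ h => typeData_disjoint h, totalWeight,
    Finset.mul_sum, Nat.cast_sum]
  exact Finset.sum_congr rfl fun τ _ => card_typeData τ

variable (F r) in
/-- The sum of the weights of the `admissibleTriples`. -/
def admissibleWeight : ℝ :=
  ∑ i ∈ admissibleTriples F r, weight F i.1

open scoped Classical in
theorem admissibleWeight_eq : admissibleWeight F r =
    totalWeight F r * Fintype.card (Fin (n + 1) → Fˣ) *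
      ∏ _x : F, unramifiedCount F (Idx r) * totalWeight F r := by
  rw [admissibleWeight, sum_eq_of_mem_iff_and_forall_mem (fun _ _ => True)
    (fun _ _ => admissibleData F (Idx r)) (fun _ _ => card_admissibleData) (weight F)
    (by simp [admissibleTriples])]
  simp only [Finset.filter_true, Finset.card_univ, ← Finset.sum_mul, totalWeight]

open scoped Classical in
theorem card_filter_localSum_eq (hr : ∀ j, r j ∣ Fintype.card F - 1) (c : Fin (n + 1) → Fˣ)
    (k : ℕ) :
    (#{b ∈ admissibleData F (Idx r) | localSum c (fun α => (b α).1) = k} : ℝ) =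
      unramifiedCount F (Idx r) * valueWeight F r k := by
  rw [card_filter_admissibleData, Nat.cast_sum, valueWeight, Finset.mul_sum]
  refine Finset.sum_congr rfl fun τ _ => ?_
  rw [card_filter_eq_frac _ _ Nat.card_pos.ne' (fun b hb => localSum_eq_zero_or c hb)
    (sum_localSum (ne_zero_of_dvd_card_sub_one hr) c τ), card_typeData, mul_assoc]

open scoped Classical in
theorem sum_weight_mul_card_filter_inftySum_eq (k : ℕ) :
    ∑ τ : Option (Idx r), weight F τ *
      #{c : Fin (n + 1) → Fˣ | inftySum r c (typeVec τ) = k} =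
    valueWeight F r k * Fintype.card (Fin (n + 1) → Fˣ) := by
  rw [valueWeight, Finset.sum_mul]
  refine Finset.sum_congr rfl fun τ _ => ?_
  rw [card_filter_eq_frac _ _ Nat.card_pos.ne' (fun c _ => inftySum_eq_zero_or c _)
    (by rw [sum_inftySum, Finset.card_univ]), Finset.card_univ]
  ring

open scoped Classical in
theorem sum_weight_matchingTriples_eq_mul_prod (hr : ∀ j, r j ∣ Fintype.card F - 1)
    (e : OnePoint F → ℕ) :
    ∑ i ∈ matchingTriples r e, weight F i.1 =
      valueWeight F r (e OnePoint.infty) * Fintype.card (Fin (n + 1) → Fˣ) *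
        ∏ x : F, unramifiedCount F (Idx r) * valueWeight F r (e (OnePoint.some x)) := by
  let T (c : Fin (n + 1) → Fˣ) (x : F) : Finset (Idx r → F × F) :=
    {b ∈ admissibleData F (Idx r) | localSum c (fun α => (b α).1) = e (OnePoint.some x)}
  have hT (c : Fin (n + 1) → Fˣ) (x : F) : (#(T c x) : ℝ) =
      unramifiedCount F (Idx r) * valueWeight F r (e (OnePoint.some x)) :=
    card_filter_localSum_eq hr c (e (OnePoint.some x))
  rw [← sum_weight_mul_card_filter_inftySum_eq, sum_eq_of_mem_iff_and_forall_mem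
    (fun τ c => inftySum r c (typeVec τ) = e OnePoint.infty) T hT (weight F) fun i => ?_]
  simp only [mem_matchingTriples, T, Finset.mem_filter]

theorem sum_weight_matchingTriples (hr : ∀ j, r j ∣ Fintype.card F - 1) (e : OnePoint F → ℕ) :
    ∑ i ∈ matchingTriples r e, weight F i.1 =
      admissibleWeight F r * ∏ x, valueWeight F r (e x) / totalWeight F r := by
  classical
  have hT := (totalWeight_pos (F := F) (r := r)).ne'
  have hsplit (f : OnePoint F → ℝ) : ∏ x, f x = f OnePoint.infty * ∏ x : F, f (OnePoint.some x) :=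
    Fintype.prod_option (α := F) f
  rw [sum_weight_matchingTriples_eq_mul_prod hr, admissibleWeight_eq, hsplit, mul_mul_mul_comm,
    ← Finset.prod_mul_distrib]
  congr 1
  · field_simp
  · exact Finset.prod_congr rfl fun x _ => by field_simp

theorem admissibleWeight_pos : 0 < admissibleWeight F r := by
  classical
  have hq : (1 : ℝ) < Fintype.card F := Nat.one_lt_cast.2 Fintype.one_lt_card
  have hT := totalWeight_pos (F := F) (r := r)
  have hU : 0 < unramifiedCount F (Idx r) := pow_pos (mul_pos (by linarith) (by linarith)) _
  have : 0 < Fintype.card (Fin (n + 1) → Fˣ) := Fintype.card_pos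
  rw [admissibleWeight_eq]
  positivity

end Loci

end AbelianCovers

end

theorem mainTheorem2 {F : Type*} [Field F] [Fintype F] (n : ℕ) (r : Fin (n + 1) → ℕ)
    (hr_pos : ∀ j, 0 < r j)
    (hr_dvd : ∀ j : Fin n, r j.castSucc ∣ r j.succ)
    (hq : Fintype.card F ≡ 1 [MOD r (Fin.last n)]) :
    ∃ K : ℝ, ∀ χ : ℕ → MulChar F ℂ, (∀ m, m ∣ r (Fin.last n) → orderOf (χ m) = m) →
      ∀ d : Idx r → ℕ, (∀ j, ∑ α : Idx r, (α.1 j : ℕ) * d α ≡ 0 [MOD r j]) →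
      ∀ e : OnePoint F → ℕ,
        (∀ x, e x = 0 ∨ ∃ s, s ∣ r (Fin.last n) ∧ e x = groupOrder r / s) →
        ∃ δ : ℝ,
          |δ| ≤ K * (Fintype.card F : ℝ) ^ (-((⨅ α, d α : ℕ) : ℝ) / 2) ∧
          ({p ∈ Fhat F r d | ∀ x : OnePoint F, charSum χ p x = (e x : ℂ)}.ncard : ℝ) /
              ((Fhat F r d).ncard : ℝ) =
            mainTerm r e * (1 + δ) := by
  have hr (j : Fin (n + 1)) : r j ∣ Fintype.card F - 1 :=
    (dvd_last hr_dvd j).trans ((Nat.modEq_iff_dvd' Fintype.card_pos).1 hq.symm)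
  obtain ⟨K, hK⟩ := exists_ncard_jetLocus_div_eq (admissibleTriples F r)
  refine ⟨K, fun χ hχ d hd e he => ?_⟩
  have hmain : mainTerm r e =
      (∑ i ∈ matchingTriples r e, weight F i.1) / ∑ i ∈ admissibleTriples F r, weight F i.1 := by
    rw [mainTerm_eq hr hr_dvd e he, sum_weight_matchingTriples hr, ← admissibleWeight,
      mul_div_cancel_left₀ _ admissibleWeight_pos.ne']
  rw [card_rpow_neg_div_two, setOf_charSum_eq_jetLocus hr hr_dvd hχ hd, Fhat_eq_jetLocus, hmain]
  exact hK _ d _ (matchingTriples_subset e) fun α => ciInf_le (OrderBot.bddBelow _) α
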